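/- Let $n\in\mathbb{N}$, let $a<b$ be real, let $\gamma\in C^\infty([a,b];\mathbb{R}^n)$ be parametrized by arc-length, i.e. $|\gamma'|\equiv 1$, and let $\varrho\in C^\infty([a,b];\mathbb{R}_{>0})$. For a regular curve $\gamma$ and a function $g$ on $[a,b]$ write $\frac{dg}{ds}=\frac{g'}{|\gamma'|}$, $ds=|\gamma'|\,dx$ and $T=\frac{d\gamma}{ds}$, and let the bending energy with bending stiffness $\varrho$ be $$\mathcal{B}_\varrho(\gamma)=\tfrac12\int_a^b\varrho\,\big\langle \tfrac{dT}{ds},\tfrac{dT}{ds}\big\rangle\,ds .$$ A smooth variation of $\gamma$ is a family $(\gamma_t)_{t\in[-\varepsilon,\varepsilon]}$, $\varepsilon>0$, with $\gamma_0=\gamma$ such that $(t,x)\mapsto\gamma_t(x)\in\mathbb{R}^n$ is smooth on $[-\varepsilon,\varepsilon]\times[a,b]$. It has compact support in the interior if there is $\delta>0$ with $\gamma_t(x)=\gamma(x)$ for all $t$ and all $x\in[a,b]$ with $x\le a+\delta$ or $x\ge b-\delta$; it preserves arc-length if $|\gamma_t'|=|\gamma'|$ on $[a,b]$ for all $t$.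 The curve $\gamma$ is called elastic with bending stiffness $\varrho$ if $\frac{d}{dt}\big|_{t=0}\mathcal{B}_\varrho(\gamma_t)=0$ for every smooth variation $(\gamma_t)$ of $\gamma$ that has compact support in the interior and preserves arc-length. Let $$\mathcal{G}^{\mathcal{B}}=\varrho \tfrac{d^3T}{ds^3} + 3 \varrho \big\langle \tfrac{d^2T}{ds^2} , \tfrac{dT}{ds} \big\rangle T + \tfrac{3}{2} \varrho \big\langle \tfrac{dT}{ds} , \tfrac{dT}{ds} \big\rangle \tfrac{dT}{ds}+\tfrac{d^2\varrho}{ds^2} \tfrac{dT}{ds}+ \tfrac{d\varrho}{ds}\Big(2 \tfrac{d^2T}{ds^2}+ \tfrac{3}{2} \big\langle \tfrac{dT}{ds} , \tfrac{dT}{ds} \big\rangle T\Big).$$ Then the following are equivalent: 1. $\gamma$ is elastic with bending stiffness $\varrho$; 2. there is $\Lambda\in C^\infty([a,b];\mathbb{R})$ such that, on $[a,b]$, $$\mathcal{G}^{\mathcal{B}}-2\Lambda'T-2\Lambda T'=0;$$ 3. there is $\Lambda\in C^\infty([a,b];\mathbb{R})$ such that, on $[a,b]$, $$\varrho T'''+3\varrho\langle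 T',T''\rangle T+\tfrac32\varrho\langle T',T'\rangle T'+\varrho''T'+2\varrho'T''+\tfrac32\varrho'\langle T',T'\rangle T-\Lambda'T-\Lambda T'=0;$$ 4. there is $\Lambda\in C^\infty([a,b];\mathbb{R})$ such that, on $[a,b]$, $$\varrho\gamma''''+3\varrho\langle\gamma''',\gamma''\rangle\gamma'+\tfrac32\varrho\langle\gamma'',\gamma''\rangle\gamma''+\varrho''\gamma''+2\varrho'\gamma'''+\tfrac32\varrho'\langle\gamma'',\gamma''\rangle\gamma'-\Lambda'\gamma'-\Lambda\gamma''=0.$$ Moreover, for every $\Lambda\in C^\infty([a,b];\mathbb{R})$, the equation in (2) holds for $\Lambda$ if and only if the equation in (3) holds for $2\Lambda$, and the equation in (3) holds for $\Lambda$ if and only if the equation in (4) holds for $\Lambda$. -/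

import Mathlib

open scoped ContDiff

noncomputable section

namespace VariableStiffness

/-- Euclidean `n`-space. -/
abbrev E (n : ℕ) : Type := EuclideanSpace ℝ (Fin n)

/-- The derivative with respect to the arc-length of `γ` of a function `g` on `[a, b]`:
`dg/ds = g' / |γ'|`. Derivatives of functions on `[a, b]` are derivatives within `[a, b]`
(one-sided at the end points). -/
def dds {n : ℕ} {F : Type*} [NormedAddCommGroup F] [NormedSpace ℝ F]
    (a b : ℝ) (γ : ℝ → E n) (g : ℝ → F) : ℝ → F :=
  fun x => ‖derivWithin γ (Set.Icc a b) x‖⁻¹ • derivWithin g (Set.Icc a b) x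

/-- The unit tangent field `T = dγ/ds`. -/
def tangent {n : ℕ} (a b : ℝ) (γ : ℝ → E n) : ℝ → E n := dds a b γ γ

/-- The curve `γ` on `[a, b]` is parametrized by arc-length: `|γ'| ≡ 1`. -/
def IsArcLengthParam {n : ℕ} (a b : ℝ) (γ : ℝ → E n) : Prop :=
  ∀ x ∈ Set.Icc a b, ‖derivWithin γ (Set.Icc a b) x‖ = 1

/-- The bending energy `(1/2) ∫ ϱ ⟨dT/ds, dT/ds⟩ ds` with bending stiffness `ϱ`, where
`ds = |γ'| dx`. -/
def bendingEnergy {n : ℕ} (a b : ℝ) (ϱ : ℝ → ℝ) (γ : ℝ → E n) : ℝ :=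
  (1 / 2) * ∫ x in a..b,
    ϱ x * inner ℝ (dds a b γ (tangent a b γ) x) (dds a b γ (tangent a b γ) x)
      * ‖derivWithin γ (Set.Icc a b) x‖

/-- `γt`, with parameter `t ∈ [-ε, ε]`, is a smooth variation of `γ` on `[a, b]`: the map
`(t, x) ↦ γt t x` is smooth on `[-ε, ε] × [a, b]`, and `γt 0 = γ`. -/
structure IsSmoothVariation {n : ℕ} (a b : ℝ) (γ : ℝ → E n) (ε : ℝ) (γt : ℝ → ℝ → E n) :
    Prop where
  eps_pos : 0 < ε
  smooth : ContDiffOn ℝ ∞ (fun p : ℝ × ℝ => γt p.1 p.2) (Set.Icc (-ε) ε ×ˢ Set.Icc a b)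
  at_zero : ∀ x ∈ Set.Icc a b, γt 0 x = γ x

/-- The variation has compact support in the interior of `[a, b]`: there is `δ > 0` such that
no `γt t` moves the points of `[a, a + δ] ∪ [b - δ, b]`. -/
def HasCompactSupportInInterior {n : ℕ} (a b : ℝ) (γ : ℝ → E n) (ε : ℝ)
    (γt : ℝ → ℝ → E n) : Prop :=
  ∃ δ > 0, ∀ t ∈ Set.Icc (-ε) ε, ∀ x ∈ Set.Icc a b,
    x ∈ Set.Icc a (a + δ) ∪ Set.Icc (b - δ) b → γt t x = γ x

/-- The variation preserves arc-length: `|γt'| = |γ'|` pointwise on `[a, b]`, for all `t`. -/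
def PreservesArcLength {n : ℕ} (a b : ℝ) (γ : ℝ → E n) (ε : ℝ) (γt : ℝ → ℝ → E n) : Prop :=
  ∀ t ∈ Set.Icc (-ε) ε, ∀ x ∈ Set.Icc a b,
    ‖derivWithin (γt t) (Set.Icc a b) x‖ = ‖derivWithin γ (Set.Icc a b) x‖

/-- The arc-length parametrized curve `γ` is elastic with bending stiffness `ϱ`: it is a critical
point of the bending energy under all smooth variations that have compact support in the
interior of `[a, b]` and preserve arc-length. -/
def IsElastic {n : ℕ} (a b : ℝ) (ϱ : ℝ → ℝ) (γ : ℝ → E n) : Prop :=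
  IsArcLengthParam a b γ ∧
  ∀ (ε : ℝ) (γt : ℝ → ℝ → E n), IsSmoothVariation a b γ ε γt →
    HasCompactSupportInInterior a b γ ε γt → PreservesArcLength a b γ ε γt →
    HasDerivAt (fun t => bendingEnergy a b ϱ (γt t)) 0 0

/-- The variational gradient of the bending energy with bending stiffness,
`ϱ d³T/ds³ + 3ϱ⟨d²T/ds², dT/ds⟩T + (3/2)ϱ⟨dT/ds, dT/ds⟩dT/ds + d²ϱ/ds² dT/ds
  + dϱ/ds (2 d²T/ds² + (3/2)⟨dT/ds, dT/ds⟩T)`. -/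
def bendingGradient {n : ℕ} (a b : ℝ) (ϱ : ℝ → ℝ) (γ : ℝ → E n) (x : ℝ) : E n :=
  let T := tangent a b γ
  let T₁ := dds a b γ T
  let T₂ := dds a b γ T₁
  let T₃ := dds a b γ T₂
  let ϱ₁ := dds a b γ ϱ
  let ϱ₂ := dds a b γ ϱ₁
  ϱ x • T₃ x + (3 * ϱ x * inner ℝ (T₂ x) (T₁ x)) • T x
    + (3 / 2 * ϱ x * inner ℝ (T₁ x) (T₁ x)) • T₁ x
    + ϱ₂ x • T₁ x
    + ϱ₁ x • ((2 : ℝ) • T₂ x + (3 / 2 * inner ℝ (T₁ x) (T₁ x)) • T x)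

/-- The gradient with Lagrange multiplier `Λ`: the bending gradient minus `2 Λ' T + 2 Λ T'`. -/
def constrainedGradient {n : ℕ} (a b : ℝ) (ϱ : ℝ → ℝ) (γ : ℝ → E n) (Λ : ℝ → ℝ) (x : ℝ) :
    E n :=
  bendingGradient a b ϱ γ x
    - (2 * derivWithin Λ (Set.Icc a b) x) • tangent a b γ x
    - (2 * Λ x) • derivWithin (tangent a b γ) (Set.Icc a b) x

/-- The third-order equation for a vector field `T` on `[a, b]`:
`ϱT''' + 3ϱ⟨T', T''⟩T + (3/2)ϱ⟨T', T'⟩T' + ϱ''T' + 2ϱ'T'' + (3/2)ϱ'⟨T', T'⟩T - Λ'T - ΛT' = 0`. -/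
def TangentODE {n : ℕ} (a b : ℝ) (ϱ : ℝ → ℝ) (Λ : ℝ → ℝ) (T : ℝ → E n) : Prop :=
  let T' := iteratedDerivWithin 1 T (Set.Icc a b)
  let T'' := iteratedDerivWithin 2 T (Set.Icc a b)
  let T''' := iteratedDerivWithin 3 T (Set.Icc a b)
  let ϱ' := iteratedDerivWithin 1 ϱ (Set.Icc a b)
  let ϱ'' := iteratedDerivWithin 2 ϱ (Set.Icc a b)
  let Λ' := iteratedDerivWithin 1 Λ (Set.Icc a b)
  ∀ x ∈ Set.Icc a b,
    ϱ x • T''' x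
      + (3 * ϱ x * inner ℝ (T' x) (T'' x)) • T x
      + (3 / 2 * ϱ x * inner ℝ (T' x) (T' x)) • T' x
      + ϱ'' x • T' x
      + (2 * ϱ' x) • T'' x
      + (3 / 2 * ϱ' x * inner ℝ (T' x) (T' x)) • T x
      - Λ' x • T x
      - Λ x • T' x = 0

/-- The fourth-order equation for a curve `γ` on `[a, b]`:
`ϱγ'''' + 3ϱ⟨γ''', γ''⟩γ' + (3/2)ϱ⟨γ'', γ''⟩γ'' + ϱ''γ'' + 2ϱ'γ''' + (3/2)ϱ'⟨γ'', γ''⟩γ'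
  - Λ'γ' - Λγ'' = 0`. -/
def CurveODE {n : ℕ} (a b : ℝ) (ϱ : ℝ → ℝ) (Λ : ℝ → ℝ) (γ : ℝ → E n) : Prop :=
  let γ' := iteratedDerivWithin 1 γ (Set.Icc a b)
  let γ'' := iteratedDerivWithin 2 γ (Set.Icc a b)
  let γ''' := iteratedDerivWithin 3 γ (Set.Icc a b)
  let γ'''' := iteratedDerivWithin 4 γ (Set.Icc a b)
  let ϱ' := iteratedDerivWithin 1 ϱ (Set.Icc a b)
  let ϱ'' := iteratedDerivWithin 2 ϱ (Set.Icc a b)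
  let Λ' := iteratedDerivWithin 1 Λ (Set.Icc a b)
  ∀ x ∈ Set.Icc a b,
    ϱ x • γ'''' x
      + (3 * ϱ x * inner ℝ (γ''' x) (γ'' x)) • γ' x
      + (3 / 2 * ϱ x * inner ℝ (γ'' x) (γ'' x)) • γ'' x
      + ϱ'' x • γ'' x
      + (2 * ϱ' x) • γ''' x
      + (3 / 2 * ϱ' x * inner ℝ (γ'' x) (γ'' x)) • γ' x
      - Λ' x • γ' x
      - Λ x • γ'' x = 0

end VariableStiffness

end

noncomputable section

namespace VariableStiffness

open MeasureTheory Set Filter Topology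

/-! Write `T = γ'` and `Q = (ϱT')'`. Since `γ` has unit speed, arc-length derivatives are ordinary
derivatives, so (2), (3) and (4) are the same equation up to a factor 2 in `Λ`. Its left-hand side
is an exact derivative, that of `Q + (3/2 ϱ|T'|² - Λ) T`. Hence some smooth `Λ` solves the equation
iff there are a constant vector `c` and a smooth function `f` with `Q - c = f T`.

For an admissible variation with velocity `X`, the first variation is `∫ ϱ⟨T', X''⟩ = -∫ ⟨Q, X'⟩`,
and preservation of arc-length gives `⟨T, X'⟩ = 0`. If `Q - c` is a multiple of `T`, this is `-∫ ⟨c,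
X'⟩ = 0`, so the equation implies elasticity.

The converse needs enough variations. A compactly supported normal field with zero integral should
be the velocity `X'` of the tangent along an admissible variation. Renormalizing `T + u` keeps unit
speed, but the integrated curve may fail to close up with `γ` near `b`. A correction with `n`
further parameters and the inverse function theorem remove this defect
(`exists_variation_of_field`), provided that integrals of normal fields fill the whole space. They
do as soon as `T'` is nonzero at one interior point (`exists_fields_with_integral`). Then `c` is the
Lagrange multiplier of the closing condition, and testing against bumps times the normal part of `Q
- c` shows that this part vanishes. If `T'` vanishes identically, `Λ = 0` works. -/

/-! ### Parametric integrals, smooth local inverses, extension by zero -/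

/-- Differentiation under the integral sign for a jointly smooth integrand. -/
theorem hasFDerivAt_parametric_integral {H F : Type} [NormedAddCommGroup H] [NormedSpace ℝ H]
    [FiniteDimensional ℝ H] [NormedAddCommGroup F] [NormedSpace ℝ F]
    {g : H × ℝ → F} (hg : ContDiff ℝ 1 g) (a b : ℝ) (p : H) :
    HasFDerivAt (fun p => ∫ u in a..b, g (p, u))
      (∫ u in a..b, (fderiv ℝ g (p, u)).comp (ContinuousLinearMap.inl ℝ H ℝ)) p := by
  have hc : Continuous fun q : H × ℝ =>
      (fderiv ℝ g q).comp (ContinuousLinearMap.inl ℝ H ℝ) :=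
    (hg.continuous_fderiv (by simp)).clm_comp continuous_const
  obtain ⟨K, hK⟩ := ((isCompact_closedBall p 1).prod
    (isCompact_uIcc (a := a) (b := b))).exists_bound_of_continuousOn hc.continuousOn
  refine intervalIntegral.hasFDerivAt_integral_of_dominated_of_fderiv_le
    (F := fun p u => g (p, u))
    (F' := fun p u => (fderiv ℝ g (p, u)).comp (ContinuousLinearMap.inl ℝ H ℝ))
    (bound := fun _ => K) (Metric.closedBall_mem_nhds p one_pos) ?_ ?_ ?_ ?_ ?_ ?_
  · exact Eventually.of_forall fun q =>
      (hg.continuous.comp (Continuous.prodMk_right q)).aestronglyMeasurable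
  · exact (hg.continuous.comp (Continuous.prodMk_right p)).intervalIntegrable _ _
  · exact (hc.comp (Continuous.prodMk_right p)).aestronglyMeasurable
  · exact Eventually.of_forall fun u hu q hq => hK (q, u) ⟨hq, uIoc_subset_uIcc hu⟩
  · exact intervalIntegrable_const
  · refine Eventually.of_forall fun u _ q _ => ?_
    have h1 := (hg.differentiable (by simp) (q, u)).hasFDerivAt
    exact h1.comp q (hasFDerivAt_prodMk_left q u)

/-- The derivative is again a parametric integral, but of an operator-valued integrand. The target
`F` is therefore quantified inside the induction on `k`. -/
theorem contDiff_nat_parametric_integral {H : Type} [NormedAddCommGroup H] [NormedSpace ℝ H]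
    [FiniteDimensional ℝ H] (a b : ℝ) (k : ℕ) :
    ∀ {F : Type} [NormedAddCommGroup F] [NormedSpace ℝ F] {g : H × ℝ → F},
      ContDiff ℝ ∞ g → ContDiff ℝ k (fun p => ∫ u in a..b, g (p, u)) := by
  induction k with
  | zero =>
    intro F _ _ g hg
    have hd : Differentiable ℝ (fun p => ∫ u in a..b, g (p, u)) := fun p =>
      (hasFDerivAt_parametric_integral (hg.of_le (by simp)) a b p).differentiableAt
    exact contDiff_zero.2 hd.continuous
  | succ k ih =>
    intro F _ _ g hg
    have hd := hasFDerivAt_parametric_integral (hg.of_le (m := 1) (by simp)) a b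
    push_cast
    refine (contDiff_succ_iff_fderiv).2 ⟨fun p => (hd p).differentiableAt, by simp, ?_⟩
    have : fderiv ℝ (fun p => ∫ u in a..b, g (p, u)) = fun p =>
        ∫ u in a..b, (fderiv ℝ g (p, u)).comp (ContinuousLinearMap.inl ℝ H ℝ) :=
      funext fun p => (hd p).fderiv
    rw [this]
    exact ih (g := fun q => (fderiv ℝ g q).comp (ContinuousLinearMap.inl ℝ H ℝ))
      ((hg.fderiv_right (by simp)).clm_comp contDiff_const)

theorem contDiff_parametric_integral {H F : Type} [NormedAddCommGroup H] [NormedSpace ℝ H]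
    [FiniteDimensional ℝ H] [NormedAddCommGroup F] [NormedSpace ℝ F]
    {g : H × ℝ → F} (hg : ContDiff ℝ ∞ g) (a b : ℝ) :
    ContDiff ℝ ∞ (fun p => ∫ u in a..b, g (p, u)) :=
  contDiff_infty.2 fun k => contDiff_nat_parametric_integral a b k hg

/-- A primitive in the last variable of a jointly smooth function is jointly smooth. -/
theorem contDiff_parametric_primitive {H F : Type} [NormedAddCommGroup H] [NormedSpace ℝ H]
    [FiniteDimensional ℝ H] [NormedAddCommGroup F] [NormedSpace ℝ F]
    {g : H × ℝ → F} (hg : ContDiff ℝ ∞ g) (a : ℝ) :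
    ContDiff ℝ ∞ (fun q : H × ℝ => ∫ y in a..q.2, g (q.1, y)) := by
  -- Rescaling to `[0, 1]` moves the variable endpoint into the integrand.
  have h : (fun q : H × ℝ => ∫ y in a..q.2, g (q.1, y)) = fun q : H × ℝ =>
      (q.2 - a) • ∫ u in (0 : ℝ)..1, g (q.1, a + (q.2 - a) * u) := by
    funext q
    have := intervalIntegral.smul_integral_comp_add_mul (a := 0) (b := 1)
      (fun y => g (q.1, y)) (q.2 - a) a
    rw [this]
    simp
  rw [h]
  refine (contDiff_snd.sub contDiff_const).smul
    (contDiff_parametric_integral (g := fun r : (H × ℝ) × ℝ =>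
      g (r.1.1, a + (r.1.2 - a) * r.2)) ?_ 0 1)
  exact hg.comp (by fun_prop)

/-- The inverse function theorem, with smoothness of the local inverse in a whole
neighbourhood. -/
theorem exists_smooth_local_inverse {H : Type} [NormedAddCommGroup H] [NormedSpace ℝ H]
    [CompleteSpace H] {Φ : H → H} (hΦ : ContDiff ℝ ∞ Φ) (h0 : Φ 0 = 0)
    (hd : HasFDerivAt Φ (ContinuousLinearMap.id ℝ H) 0) :
    ∃ Ψ : H → H, Ψ 0 = 0 ∧ (∀ᶠ y in 𝓝 0, ContDiffAt ℝ ∞ Ψ y ∧ Φ (Ψ y) = y) ∧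
      HasFDerivAt Ψ (ContinuousLinearMap.id ℝ H) 0 := by
  have hd' : HasFDerivAt Φ ((ContinuousLinearEquiv.refl ℝ H : H ≃L[ℝ] H) : H →L[ℝ] H) 0 := hd
  have hs : HasStrictFDerivAt Φ ((ContinuousLinearEquiv.refl ℝ H : H ≃L[ℝ] H) : H →L[ℝ] H) 0 :=
    hΦ.contDiffAt.hasStrictFDerivAt' hd' (by simp)
  set e := hs.toOpenPartialHomeomorph Φ with he
  have hcoe : ∀ x, e x = Φ x := fun x => rfl
  have h0s : (0 : H) ∈ e.source := hs.mem_toOpenPartialHomeomorph_source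
  have h0t : (0 : H) ∈ e.target := by
    have := e.map_source h0s
    rwa [hcoe, h0] at this
  have hsymm0 : e.symm 0 = 0 := by
    have := e.left_inv h0s
    rwa [hcoe, h0] at this
  -- Invertible operators form an open set, so the derivative stays invertible near `0`; this gives
  -- smoothness of the inverse at all nearby points.
  have hinv : ∀ᶠ x in 𝓝 (0 : H),
      fderiv ℝ Φ x ∈ range ((↑) : (H ≃L[ℝ] H) → H →L[ℝ] H) := by
    refine (hΦ.continuous_fderiv (by simp)).continuousAt.eventually ?_
    rw [hd'.fderiv]
    exact ContinuousLinearEquiv.nhds _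
  have hcs : ContinuousAt e.symm 0 := e.continuousAt_symm h0t
  have hinv' := hcs.eventually (by rw [hsymm0]; exact hinv)
  refine ⟨e.symm, hsymm0, ?_, ?_⟩
  · filter_upwards [hinv', e.open_target.mem_nhds h0t] with y ⟨A, hA⟩ hy
    refine ⟨e.contDiffAt_symm (f₀' := A) hy ?_ hΦ.contDiffAt, e.right_inv hy⟩
    rw [hA]
    exact (hΦ.differentiable (by simp) _).hasFDerivAt
  · have := e.hasFDerivAt_symm (f' := ContinuousLinearEquiv.refl ℝ H) h0t
      (by rw [hsymm0]; exact hd')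
    exact this

/-- A function that is smooth over the open interval and vanishes near its end points is
smooth. -/
theorem contDiffOn_of_vanish_near_endpoints {H F : Type} [NormedAddCommGroup H]
    [NormedSpace ℝ H] [NormedAddCommGroup F] [NormedSpace ℝ F] {A : Set H} (hA : IsOpen A)
    {a b δ : ℝ} (hδ : 0 < δ) {f : H × ℝ → F} (hf : ContDiffOn ℝ ∞ f (A ×ˢ Ioo a b))
    (h0 : ∀ p ∈ A, ∀ x, x ∉ Ioo (a + δ) (b - δ) → f (p, x) = 0) :
    ContDiffOn ℝ ∞ f (A ×ˢ univ) := by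
  rintro ⟨p, x⟩ ⟨hp, -⟩
  refine ContDiffAt.contDiffWithinAt ?_
  by_cases hx : x ∈ Ioo a b
  · exact hf.contDiffAt ((hA.prod isOpen_Ioo).mem_nhds ⟨hp, hx⟩)
  · have hx' : x ∈ (Icc (a + δ) (b - δ))ᶜ := fun h =>
      hx ⟨by linarith [h.1], by linarith [h.2]⟩
    have : f =ᶠ[𝓝 (p, x)] fun _ => 0 := by
      filter_upwards [(hA.prod isClosed_Icc.isOpen_compl).mem_nhds ⟨hp, hx'⟩] with q hq
      exact h0 q.1 hq.1 q.2 fun h => hq.2 ⟨h.1.le, h.2.le⟩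
    exact contDiffAt_const.congr_of_eventuallyEq this

theorem contDiff_of_vanish_near_endpoints {F : Type} [NormedAddCommGroup F] [NormedSpace ℝ F]
    {a b δ : ℝ} (hδ : 0 < δ) {f : ℝ → F} (hf : ContDiffOn ℝ ∞ f (Ioo a b))
    (h0 : ∀ x, x ∉ Ioo (a + δ) (b - δ) → f x = 0) : ContDiff ℝ ∞ f := by
  have := contDiffOn_of_vanish_near_endpoints (H := ℝ) isOpen_univ (f := fun p => f p.2) hδ
    (hf.comp contDiff_snd.contDiffOn fun p hp => hp.2) (fun _ _ x hx => h0 x hx)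
  rw [univ_prod_univ, contDiffOn_univ] at this
  exact this.comp (contDiff_prodMk_right (0 : ℝ))

/-! ### Mixed partials, bump functions, derivatives on a closed interval -/

/-- Partial derivatives of a smooth function commute. -/
theorem fderiv_fderiv_apply_comm {H F : Type} [NormedAddCommGroup H] [NormedSpace ℝ H]
    [NormedAddCommGroup F] [NormedSpace ℝ F] {U : Set H} (hU : IsOpen U) {f : H → F}
    (hf : ContDiffOn ℝ ∞ f U) (v w : H) {p : H} (hp : p ∈ U) :
    fderiv ℝ (fun q => fderiv ℝ f q v) p w = fderiv ℝ (fun q => fderiv ℝ f q w) p v := by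
  have hfp : ContDiffAt ℝ ∞ f p := hf.contDiffAt (hU.mem_nhds hp)
  have hd : DifferentiableAt ℝ (fderiv ℝ f) p :=
    (hfp.fderiv_right (m := ∞) (by simp)).differentiableAt (by simp)
  have hs : IsSymmSndFDerivAt ℝ f p := hfp.isSymmSndFDerivAt (by
    rw [minSmoothness_of_isRCLikeNormedField]; exact ENat.LEInfty.out)
  rw [fderiv_clm_apply hd (differentiableAt_const _),
    fderiv_clm_apply hd (differentiableAt_const _)]
  simpa using hs w v

theorem contDiffOn_fderiv_apply {H F : Type} [NormedAddCommGroup H] [NormedSpace ℝ H]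
    [NormedAddCommGroup F] [NormedSpace ℝ F] {U : Set H} (hU : IsOpen U) {f : H → F}
    (hf : ContDiffOn ℝ ∞ f U) (v : H) : ContDiffOn ℝ ∞ (fun q => fderiv ℝ f q v) U :=
  (hf.fderiv_of_isOpen hU (by simp)).clm_apply contDiffOn_const

/-- If the integral of a nonnegative function against a nonnegative bump vanishes, so does the
function wherever the bump does not. -/
theorem eq_zero_of_integral_mul_eq_zero {a b x₀ : ℝ} {χ f : ℝ → ℝ}
    (hχf : ContinuousOn (fun x => χ x * f x) (Icc a b))
    (hχ : ∀ x, 0 ≤ χ x) (hf : ∀ x, 0 ≤ f x) (hx₀ : x₀ ∈ Ioo a b) (h1 : χ x₀ ≠ 0)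
    (h : ∫ x in a..b, χ x * f x = 0) : f x₀ = 0 := by
  by_contra hne
  have hlt : a < b := hx₀.1.trans hx₀.2
  have := intervalIntegral.integral_pos hlt hχf
    (fun x _ => mul_nonneg (hχ x) (hf x))
    ⟨x₀, Ioo_subset_Icc_self hx₀, mul_pos ((hχ x₀).lt_of_ne' h1) ((hf x₀).lt_of_ne' hne)⟩
  exact this.ne' h

theorem exists_bump {a b x₀ : ℝ} (hx₀ : x₀ ∈ Ioo a b) :
    ∃ χ : ℝ → ℝ, ContDiff ℝ ∞ χ ∧ (∀ x, 0 ≤ χ x) ∧ χ x₀ ≠ 0 ∧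
      ∃ δ > 0, ∀ x, x ∉ Ioo (a + δ) (b - δ) → χ x = 0 := by
  obtain ⟨h1, h2⟩ := hx₀
  set δ := min (x₀ - a) (b - x₀) / 2 with hδdef
  have hδ : 0 < δ := by
    have : 0 < min (x₀ - a) (b - x₀) := lt_min (by linarith) (by linarith)
    positivity
  have hl : 2 * δ ≤ x₀ - a := by rw [hδdef]; linarith [min_le_left (x₀ - a) (b - x₀)]
  have hr : 2 * δ ≤ b - x₀ := by rw [hδdef]; linarith [min_le_right (x₀ - a) (b - x₀)]
  let φ : ContDiffBump x₀ := ⟨δ / 2, δ, by positivity, by linarith⟩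
  refine ⟨φ, φ.contDiff, fun x => φ.nonneg, ?_, δ, hδ, fun x hx => ?_⟩
  · rw [φ.one_of_mem_closedBall (Metric.mem_closedBall_self (by positivity))]
    exact one_ne_zero
  · apply φ.zero_of_le_dist
    change δ ≤ dist x x₀
    by_contra hlt
    rw [not_le, Real.dist_eq, abs_lt] at hlt
    exact hx ⟨by linarith [hlt.1], by linarith [hlt.2]⟩

theorem hasDerivAt_slice_fst {F : Type} [NormedAddCommGroup F] [NormedSpace ℝ F]
    {f : ℝ × ℝ → F} {t x : ℝ} (hf : DifferentiableAt ℝ f (t, x)) :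
    HasDerivAt (fun s => f (s, x)) (fderiv ℝ f (t, x) (1, 0)) t :=
  hf.hasFDerivAt.comp_hasDerivAt t ((hasDerivAt_id t).prodMk (hasDerivAt_const t x))

theorem hasDerivAt_slice_snd {F : Type} [NormedAddCommGroup F] [NormedSpace ℝ F]
    {f : ℝ × ℝ → F} {t x : ℝ} (hf : DifferentiableAt ℝ f (t, x)) :
    HasDerivAt (fun y => f (t, y)) (fderiv ℝ f (t, x) (0, 1)) x :=
  hf.hasFDerivAt.comp_hasDerivAt x ((hasDerivAt_const x t).prodMk (hasDerivAt_id x))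

theorem contDiffOn_derivWithin_Icc {F : Type} [NormedAddCommGroup F] [NormedSpace ℝ F]
    {a b : ℝ} (hab : a < b) {f : ℝ → F} (hf : ContDiffOn ℝ ∞ f (Icc a b)) :
    ContDiffOn ℝ ∞ (derivWithin f (Icc a b)) (Icc a b) :=
  hf.derivWithin (uniqueDiffOn_Icc hab) (by simp)

theorem hasDerivWithinAt_Icc {F : Type} [NormedAddCommGroup F] [NormedSpace ℝ F]
    {a b : ℝ} {f : ℝ → F} (hf : ContDiffOn ℝ ∞ f (Icc a b)) {x : ℝ} (hx : x ∈ Icc a b) :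
    HasDerivWithinAt f (derivWithin f (Icc a b) x) (Icc a b) x :=
  (hf.differentiableOn (by simp) x hx).hasDerivWithinAt

theorem hasDerivAt_Ioo {F : Type} [NormedAddCommGroup F] [NormedSpace ℝ F]
    {a b : ℝ} {f : ℝ → F} (hf : ContDiffOn ℝ ∞ f (Icc a b)) {x : ℝ} (hx : x ∈ Ioo a b) :
    HasDerivAt f (derivWithin f (Icc a b) x) x :=
  (hasDerivWithinAt_Icc hf (Ioo_subset_Icc_self hx)).hasDerivAt
    (Icc_mem_nhds hx.1 hx.2)

/-! ### Arc-length reduction and the first variation -/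

theorem dds_apply_of_norm_eq_one {n : ℕ} {F : Type*} [NormedAddCommGroup F] [NormedSpace ℝ F]
    {a b : ℝ} {γ : ℝ → E n} {x : ℝ} (h : ‖derivWithin γ (Icc a b) x‖ = 1) (g : ℝ → F) :
    dds a b γ g x = derivWithin g (Icc a b) x := by
  simp [dds, h]

theorem bendingEnergy_eq_of_isArcLengthParam {n : ℕ} {a b : ℝ} (hab : a < b) (ϱ : ℝ → ℝ)
    {γ : ℝ → E n} (h : IsArcLengthParam a b γ) :
    bendingEnergy a b ϱ γ = (1 / 2) * ∫ x in a..b,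
      ϱ x * inner ℝ (derivWithin (derivWithin γ (Icc a b)) (Icc a b) x)
        (derivWithin (derivWithin γ (Icc a b)) (Icc a b) x) := by
  unfold bendingEnergy
  congr 1
  refine intervalIntegral.integral_congr fun x hx => ?_
  rw [uIcc_of_le hab.le] at hx
  have hT : derivWithin (tangent a b γ) (Icc a b) x =
      derivWithin (derivWithin γ (Icc a b)) (Icc a b) x :=
    derivWithin_congr (fun y hy => dds_apply_of_norm_eq_one (h y hy) γ)
      (dds_apply_of_norm_eq_one (h x hx) γ)
  simp only [dds_apply_of_norm_eq_one (h x hx), hT, h x hx, mul_one]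

/-- The displacement of a smooth compactly supported variation, extended by zero, is smooth. -/
theorem contDiffOn_displacement {n : ℕ} {a b ε δ : ℝ} {γ : ℝ → E n}
    (hγ : ContDiffOn ℝ ∞ γ (Icc a b)) {γt : ℝ → ℝ → E n} (hv : IsSmoothVariation a b γ ε γt)
    (hδ : 0 < δ) (h0 : ∀ t ∈ Icc (-ε) ε, ∀ x ∈ Icc a b,
      x ∈ Icc a (a + δ) ∪ Icc (b - δ) b → γt t x = γ x) :
    ContDiffOn ℝ ∞ (fun p : ℝ × ℝ => (Icc a b).indicator (fun y => γt p.1 y - γ y) p.2)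
      (Ioo (-ε) ε ×ˢ univ) ∧
    ∀ t ∈ Icc (-ε) ε, ∀ x, x ∉ Ioo (a + δ) (b - δ) →
      (Icc a b).indicator (fun y => γt t y - γ y) x = 0 := by
  have hz : ∀ t ∈ Icc (-ε) ε, ∀ x, x ∉ Ioo (a + δ) (b - δ) →
      (Icc a b).indicator (fun y => γt t y - γ y) x = 0 := by
    intro t ht x hx
    by_cases hxI : x ∈ Icc a b
    · rw [indicator_of_mem hxI, sub_eq_zero]
      refine h0 t ht x hxI ?_
      by_cases h : x ≤ a + δ
      · exact Or.inl ⟨hxI.1, h⟩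
      · exact Or.inr ⟨by by_contra h'; exact hx ⟨not_le.1 h, not_le.1 h'⟩, hxI.2⟩
    · exact indicator_of_notMem hxI _
  refine ⟨contDiffOn_of_vanish_near_endpoints isOpen_Ioo hδ ?_
    fun t ht x hx => hz t (Ioo_subset_Icc_self ht) x hx, hz⟩
  have h1 : ContDiffOn ℝ ∞ (fun p : ℝ × ℝ => γt p.1 p.2 - γ p.2)
      (Ioo (-ε) ε ×ˢ Ioo a b) :=
    (hv.smooth.mono (prod_mono Ioo_subset_Icc_self Ioo_subset_Icc_self)).sub
      (hγ.comp contDiffOn_snd fun p hp => Ioo_subset_Icc_self hp.2)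
  exact h1.congr fun p hp => indicator_of_mem (Ioo_subset_Icc_self hp.2) _

/-- The first variation of the bending energy. -/
theorem exists_variation_field {n : ℕ} {a b : ℝ} (hab : a < b) {γ : ℝ → E n}
    (hγ : ContDiffOn ℝ ∞ γ (Icc a b)) (harc : IsArcLengthParam a b γ) {ϱ : ℝ → ℝ}
    (hϱ : ContDiffOn ℝ ∞ ϱ (Icc a b)) {ε : ℝ} {γt : ℝ → ℝ → E n}
    (hv : IsSmoothVariation a b γ ε γt) (hc : HasCompactSupportInInterior a b γ ε γt)
    (hp : PreservesArcLength a b γ ε γt) :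
    ∃ X : ℝ → E n, ContDiff ℝ ∞ X ∧
      (∃ δ > 0, ∀ x, x ∉ Ioo (a + δ) (b - δ) → X x = 0) ∧
      (∀ x ∈ Icc a b, inner ℝ (derivWithin γ (Icc a b) x) (deriv X x) = 0) ∧
      (∀ x ∈ Icc a b, HasDerivAt (fun t => γt t x) (X x) 0) ∧
      HasDerivAt (fun t => bendingEnergy a b ϱ (γt t))
        (∫ x in a..b, ϱ x * inner ℝ (derivWithin (derivWithin γ (Icc a b)) (Icc a b) x)
          (deriv (deriv X) x)) 0 := by
  obtain ⟨δ, hδ, h0⟩ := hc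
  obtain ⟨hD, hDz⟩ := contDiffOn_displacement hγ hv hδ h0
  have hε := hv.eps_pos
  have hTs := contDiffOn_derivWithin_Icc hab hγ
  have hT's := contDiffOn_derivWithin_Icc hab hTs
  set T := derivWithin γ (Icc a b) with hTdef
  set T' := derivWithin T (Icc a b) with hT'def
  -- Extended by zero, the displacement is smooth for all real `x`, so two-sided partial derivatives
  -- can be used even at `a` and `b`.
  set D : ℝ × ℝ → E n := fun p => (Icc a b).indicator (fun y => γt p.1 y - γ y) p.2 with hDdef
  set U : Set (ℝ × ℝ) := Ioo (-ε) ε ×ˢ univ with hUdef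
  have hU : IsOpen U := isOpen_Ioo.prod isOpen_univ
  have hmem : ∀ t ∈ Ioo (-ε) ε, ∀ x, (t, x) ∈ U := fun t ht x => ⟨ht, mem_univ x⟩
  have h0mem : (0 : ℝ) ∈ Ioo (-ε) ε := ⟨by linarith, hε⟩
  set Dx : ℝ × ℝ → E n := fun q => fderiv ℝ D q (0, 1) with hDxdef
  set Dxx : ℝ × ℝ → E n := fun q => fderiv ℝ Dx q (0, 1) with hDxxdef
  set Dt : ℝ × ℝ → E n := fun q => fderiv ℝ D q (1, 0) with hDtdef
  have hDx : ContDiffOn ℝ ∞ Dx U := contDiffOn_fderiv_apply hU hD _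
  have hDxx : ContDiffOn ℝ ∞ Dxx U := contDiffOn_fderiv_apply hU hDx _
  have hDt : ContDiffOn ℝ ∞ Dt U := contDiffOn_fderiv_apply hU hD _
  have hdiff : ∀ {f : ℝ × ℝ → E n}, ContDiffOn ℝ ∞ f U → ∀ t ∈ Ioo (-ε) ε, ∀ x,
      DifferentiableAt ℝ f (t, x) := fun hf t ht x =>
    (hf.contDiffAt (hU.mem_nhds (hmem t ht x))).differentiableAt (by simp)
  have hγt : ∀ t, ∀ x ∈ Icc a b, γt t x = γ x + D (t, x) := by
    intro t x hx
    simp [hDdef, indicator_of_mem hx]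
  have hγt' : ∀ t ∈ Ioo (-ε) ε, ∀ x ∈ Icc a b,
      derivWithin (γt t) (Icc a b) x = T x + Dx (t, x) := by
    intro t ht x hx
    have h1 := (hasDerivWithinAt_Icc hγ hx).add
      (hasDerivAt_slice_snd (hdiff hD t ht x)).hasDerivWithinAt
    exact (h1.congr (fun y hy => hγt t y hy) (hγt t x hx)).derivWithin
      (uniqueDiffOn_Icc hab x hx)
  have hγt'' : ∀ t ∈ Ioo (-ε) ε, ∀ x ∈ Icc a b,
      derivWithin (derivWithin (γt t) (Icc a b)) (Icc a b) x = T' x + Dxx (t, x) := by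
    intro t ht x hx
    have h1 := (hasDerivWithinAt_Icc hTs hx).add
      (hasDerivAt_slice_snd (hdiff hDx t ht x)).hasDerivWithinAt
    exact (h1.congr (fun y hy => hγt' t ht y hy) (hγt' t ht x hx)).derivWithin
      (uniqueDiffOn_Icc hab x hx)
  have hD0 : ∀ x, D (0, x) = 0 := by
    intro x
    by_cases hx : x ∈ Icc a b
    · simp [hDdef, hx, hv.at_zero x hx]
    · simp [hDdef, hx]
  have hDx0 : ∀ x, Dx (0, x) = 0 := fun x =>
    (hasDerivAt_slice_snd (hdiff hD 0 h0mem x)).unique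
      ((hasDerivAt_const x (0 : E n)).congr_of_eventuallyEq (Eventually.of_forall hD0))
  have hDxx0 : ∀ x, Dxx (0, x) = 0 := fun x =>
    (hasDerivAt_slice_snd (hdiff hDx 0 h0mem x)).unique
      ((hasDerivAt_const x (0 : E n)).congr_of_eventuallyEq (Eventually.of_forall hDx0))
  have hunit : ∀ t ∈ Ioo (-ε) ε, IsArcLengthParam a b (γt t) := fun t ht x hx =>
    (hp t (Ioo_subset_Icc_self ht) x hx).trans (harc x hx)
  -- With `X = Dt (0, ·)`, symmetry of mixed partials identifies `X'` and `X''` with the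
  -- `t`-derivatives of `Dx` and `Dxx` at `t = 0`.
  have hX1 : ∀ x, HasDerivAt (fun x => Dt (0, x)) (fderiv ℝ Dx (0, x) (1, 0)) x := by
    intro x
    have := hasDerivAt_slice_snd (hdiff hDt 0 h0mem x)
    rwa [fderiv_fderiv_apply_comm hU hD (1, 0) (0, 1) (hmem 0 h0mem x)] at this
  have hX1' : deriv (fun x => Dt (0, x)) = fun x => fderiv ℝ Dx (0, x) (1, 0) :=
    funext fun x => (hX1 x).deriv
  have hX2 : ∀ x, deriv (deriv (fun x => Dt (0, x))) x = fderiv ℝ Dxx (0, x) (1, 0) := by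
    intro x
    rw [hX1']
    have := hasDerivAt_slice_snd
      (hdiff (contDiffOn_fderiv_apply hU hDx (1, 0)) 0 h0mem x)
    rw [fderiv_fderiv_apply_comm hU hDx (1, 0) (0, 1) (hmem 0 h0mem x)] at this
    exact this.deriv
  have hev : ∀ᶠ t in 𝓝 (0 : ℝ), t ∈ Ioo (-ε) ε := isOpen_Ioo.mem_nhds h0mem
  refine ⟨fun x => Dt (0, x), ?_, ⟨δ, hδ, fun x hx => ?_⟩, fun x hx => ?_, fun x hx => ?_, ?_⟩
  · exact contDiffOn_univ.1 (hDt.comp (contDiff_prodMk_right (0 : ℝ)).contDiffOn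
      fun x _ => hmem 0 h0mem x)
  · refine (hasDerivAt_slice_fst (hdiff hD 0 h0mem x)).unique
      ((hasDerivAt_const (0 : ℝ) (0 : E n)).congr_of_eventuallyEq ?_)
    filter_upwards [hev] with t ht
    exact hDz t (Ioo_subset_Icc_self ht) x hx
  · rw [(hX1 x).deriv]
    have h1 := (hasDerivAt_slice_fst (hdiff hDx 0 h0mem x)).const_add (T x)
    have h2 := h1.inner ℝ h1
    -- The squared speed is constantly `1`; its `t`-derivative at `0` is `2⟨T, X'⟩`.
    have h3 : HasDerivAt (fun t => inner ℝ (T x + Dx (t, x)) (T x + Dx (t, x))) (0 : ℝ) 0 := by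
      refine (hasDerivAt_const (0 : ℝ) (1 : ℝ)).congr_of_eventuallyEq ?_
      filter_upwards [hev] with t ht
      rw [← hγt' t ht x hx, real_inner_self_eq_norm_sq, hunit t ht x hx]
      norm_num
    have h4 := h2.unique h3
    rw [hDx0 x, add_zero, real_inner_comm (T x)] at h4
    rw [real_inner_comm] at h4 ⊢
    linarith
  · refine ((hasDerivAt_slice_fst (hdiff hD 0 h0mem x)).const_add (γ x)).congr_of_eventuallyEq
      (Eventually.of_forall fun t => hγt t x hx)
  · set J : ℝ → ℝ → ℝ := fun t x =>
      ϱ x * inner ℝ (T' x + Dxx (t, x)) (T' x + Dxx (t, x)) with hJ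
    set J' : ℝ → ℝ → ℝ := fun t x =>
      ϱ x * (2 * inner ℝ (T' x + Dxx (t, x)) (fderiv ℝ Dxx (t, x) (1, 0))) with hJ'
    have hDxxt : ContDiffOn ℝ ∞ (fun q => fderiv ℝ Dxx q (1, 0)) U :=
      contDiffOn_fderiv_apply hU hDxx (1, 0)
    -- Halving `ε` gives a compact rectangle inside `U`, on which `J'` has the uniform bound needed
    -- for dominated differentiation.
    have hsub : Icc (-(ε / 2)) (ε / 2) ×ˢ Icc a b ⊆ U := fun q hq =>
      ⟨⟨by linarith [hq.1.1], by linarith [hq.1.2]⟩, mem_univ _⟩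
    have hJc : ContinuousOn (fun q : ℝ × ℝ => J q.1 q.2)
        (Icc (-(ε / 2)) (ε / 2) ×ˢ Icc a b) := by
      have e1 : ContinuousOn (fun q : ℝ × ℝ => T' q.2 + Dxx (q.1, q.2))
          (Icc (-(ε / 2)) (ε / 2) ×ˢ Icc a b) :=
        (hT's.continuousOn.comp continuousOn_snd fun q hq => hq.2).add
          (hDxx.continuousOn.mono hsub)
      exact (hϱ.continuousOn.comp continuousOn_snd fun q hq => hq.2).mul (e1.inner e1)
    have hJ'c : ContinuousOn (fun q : ℝ × ℝ => J' q.1 q.2)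
        (Icc (-(ε / 2)) (ε / 2) ×ˢ Icc a b) := by
      have e1 : ContinuousOn (fun q : ℝ × ℝ => T' q.2 + Dxx (q.1, q.2))
          (Icc (-(ε / 2)) (ε / 2) ×ˢ Icc a b) :=
        (hT's.continuousOn.comp continuousOn_snd fun q hq => hq.2).add
          (hDxx.continuousOn.mono hsub)
      exact (hϱ.continuousOn.comp continuousOn_snd fun q hq => hq.2).mul
        (continuousOn_const.mul (e1.inner (hDxxt.continuousOn.mono hsub)))
    have hslice : ∀ {f : ℝ → ℝ → ℝ}, ContinuousOn (fun q : ℝ × ℝ => f q.1 q.2)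
        (Icc (-(ε / 2)) (ε / 2) ×ˢ Icc a b) → ∀ t ∈ Icc (-(ε / 2)) (ε / 2),
        ContinuousOn (f t) (uIcc a b) := by
      intro f hf t ht
      rw [uIcc_of_le hab.le]
      exact hf.comp (Continuous.prodMk_right t).continuousOn fun x hx => ⟨ht, hx⟩
    have hmeas : ∀ {f : ℝ → ℝ}, ContinuousOn f (uIcc a b) →
        AEStronglyMeasurable f (volume.restrict (uIoc a b)) := fun hf =>
      (hf.mono uIoc_subset_uIcc).aestronglyMeasurable measurableSet_uIoc
    obtain ⟨K, hK⟩ := (isCompact_Icc.prod isCompact_Icc).exists_bound_of_continuousOn hJ'c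
    have hnh : Icc (-(ε / 2)) (ε / 2) ∈ 𝓝 (0 : ℝ) := Icc_mem_nhds (by linarith) (by linarith)
    have h0I : (0 : ℝ) ∈ Icc (-(ε / 2)) (ε / 2) := mem_of_mem_nhds hnh
    have hder := (intervalIntegral.hasDerivAt_integral_of_dominated_loc_of_deriv_le
      (F := J) (F' := J') (bound := fun _ => K) hnh
      (by filter_upwards [hnh] with t ht using hmeas (hslice hJc t ht))
      (hslice hJc 0 h0I).intervalIntegrable
      (hmeas (hslice hJ'c 0 h0I))
      (Eventually.of_forall fun x hx t ht => hK (t, x)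
        ⟨ht, by simpa [uIcc_of_le hab.le] using uIoc_subset_uIcc hx⟩)
      intervalIntegrable_const
      (Eventually.of_forall fun x hx t ht => by
        have h1 := (hasDerivAt_slice_fst (hdiff hDxx t
          ⟨by linarith [ht.1], by linarith [ht.2]⟩ x)).const_add (T' x)
        have h2 := (h1.inner ℝ h1).const_mul (ϱ x)
        refine h2.congr_deriv ?_
        simp only [hJ']
        rw [real_inner_comm (T' x + Dxx (t, x))]
        ring)).2
    have h5 := (hder.const_mul (1 / 2 : ℝ)).congr_of_eventuallyEq
      (f₁ := fun t => bendingEnergy a b ϱ (γt t)) (by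
        filter_upwards [hev] with t ht
        rw [bendingEnergy_eq_of_isArcLengthParam hab ϱ (hunit t ht)]
        congr 1
        refine intervalIntegral.integral_congr fun x hx => ?_
        rw [uIcc_of_le hab.le] at hx
        simp only [hJ, hγt'' t ht x hx])
    refine h5.congr_deriv ?_
    rw [← intervalIntegral.integral_const_mul]
    refine intervalIntegral.integral_congr fun x _ => ?_
    simp only [hJ', hDxx0, add_zero, hX2]
    ring

/-! ### Equivalence of the equations and the first integral -/

theorem iteratedDerivWithin_one_eq {F : Type} [NormedAddCommGroup F] [NormedSpace ℝ F]
    (f : ℝ → F) (s : Set ℝ) : iteratedDerivWithin 1 f s = derivWithin f s := by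
  funext x
  rw [iteratedDerivWithin_succ, iteratedDerivWithin_zero]

theorem iteratedDerivWithin_succ_eq {F : Type} [NormedAddCommGroup F] [NormedSpace ℝ F]
    (k : ℕ) (f : ℝ → F) (s : Set ℝ) :
    iteratedDerivWithin (k + 1) f s = derivWithin (iteratedDerivWithin k f s) s := by
  funext x
  rw [iteratedDerivWithin_succ]

theorem tangent_eqOn {n : ℕ} {a b : ℝ} {γ : ℝ → E n} (harc : IsArcLengthParam a b γ) :
    EqOn (tangent a b γ) (derivWithin γ (Icc a b)) (Icc a b) := fun x hx =>
  dds_apply_of_norm_eq_one (harc x hx) γ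

theorem dds_eqOn {n : ℕ} {F : Type} [NormedAddCommGroup F] [NormedSpace ℝ F] {a b : ℝ}
    {γ : ℝ → E n} (harc : IsArcLengthParam a b γ) {f g : ℝ → F} (h : EqOn f g (Icc a b)) :
    EqOn (dds a b γ f) (derivWithin g (Icc a b)) (Icc a b) := fun x hx =>
  (dds_apply_of_norm_eq_one (harc x hx) f).trans (derivWithin_congr h (h hx))

/-- At unit speed every `dds` is a derivative within `[a, b]`, and the factor 2 is absorbed into the
multiplier. -/
theorem constrainedGradient_eq_zero_iff_tangentODE {n : ℕ} {a b : ℝ} (hab : a < b)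
    {γ : ℝ → E n} (harc : IsArcLengthParam a b γ) (ϱ : ℝ → ℝ) {Λ : ℝ → ℝ}
    (hΛ : ContDiffOn ℝ ∞ Λ (Icc a b)) :
    (∀ x ∈ Icc a b, constrainedGradient a b ϱ γ Λ x = 0) ↔
      TangentODE a b ϱ (fun x => 2 * Λ x) (tangent a b γ) := by
  unfold TangentODE
  simp only [iteratedDerivWithin_succ_eq 2, iteratedDerivWithin_succ_eq 1,
    iteratedDerivWithin_one_eq]
  refine forall₂_congr fun x hx => ?_
  have h1 := dds_eqOn harc (fun _ _ => rfl : EqOn (tangent a b γ) (tangent a b γ) (Icc a b))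
  have h2 := dds_eqOn harc h1
  have h3 := dds_eqOn harc h2
  have r1 := dds_eqOn harc (fun _ _ => rfl : EqOn ϱ ϱ (Icc a b))
  have r2 := dds_eqOn harc r1
  have hL : derivWithin (fun x => 2 * Λ x) (Icc a b) x = 2 * derivWithin Λ (Icc a b) x :=
    ((hasDerivWithinAt_Icc hΛ hx).const_mul 2).derivWithin (uniqueDiffOn_Icc hab x hx)
  simp only [constrainedGradient, bendingGradient, h1 hx, h2 hx, h3 hx, r1 hx, r2 hx, hL]
  rw [real_inner_comm (derivWithin (tangent a b γ) (Icc a b) x)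
    (derivWithin (derivWithin (tangent a b γ) (Icc a b)) (Icc a b) x)]
  refine Eq.congr ?_ rfl
  module

theorem tangentODE_iff_curveODE {n : ℕ} {a b : ℝ} {γ : ℝ → E n}
    (harc : IsArcLengthParam a b γ) (ϱ Λ : ℝ → ℝ) :
    TangentODE a b ϱ Λ (tangent a b γ) ↔ CurveODE a b ϱ Λ γ := by
  unfold TangentODE CurveODE
  simp only [iteratedDerivWithin_succ_eq 3, iteratedDerivWithin_succ_eq 2,
    iteratedDerivWithin_succ_eq 1, iteratedDerivWithin_one_eq]
  refine forall₂_congr fun x hx => ?_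
  have h0 := tangent_eqOn harc
  have h1 : EqOn (derivWithin (tangent a b γ) (Icc a b))
      (derivWithin (derivWithin γ (Icc a b)) (Icc a b)) (Icc a b) := fun y hy =>
    derivWithin_congr h0 (h0 hy)
  have h2 : EqOn (derivWithin (derivWithin (tangent a b γ) (Icc a b)) (Icc a b))
      (derivWithin (derivWithin (derivWithin γ (Icc a b)) (Icc a b)) (Icc a b)) (Icc a b) :=
    fun y hy => derivWithin_congr h1 (h1 hy)
  have h3 := derivWithin_congr h2 (h2 hx)
  rw [h0 hx, h1 hx, h2 hx, h3, real_inner_comm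
    (derivWithin (derivWithin (derivWithin γ (Icc a b)) (Icc a b)) (Icc a b) x)
    (derivWithin (derivWithin γ (Icc a b)) (Icc a b) x)]

/-- The first integral whose derivative is the left-hand side of the fourth-order equation. -/
def momentum {n : ℕ} (a b : ℝ) (ϱ Λ : ℝ → ℝ) (γ : ℝ → E n) (x : ℝ) : E n :=
  let T := derivWithin γ (Icc a b)
  let T' := derivWithin T (Icc a b)
  derivWithin (fun y => ϱ y • T' y) (Icc a b) x
    + (3 / 2 * ϱ x * inner ℝ (T' x) (T' x) - Λ x) • T x

/-- The product rule gives `(ϱT')'' = ϱT''' + 2ϱ'T'' + ϱ''T'`, and differentiating `(3/2 ϱ|T'|² - Λ)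
T` gives all other terms. No arc-length condition enters. -/
theorem curveODE_iff_hasDerivWithinAt_momentum {n : ℕ} {a b : ℝ} (hab : a < b) {γ : ℝ → E n}
    (hγ : ContDiffOn ℝ ∞ γ (Icc a b)) {ϱ : ℝ → ℝ} (hϱ : ContDiffOn ℝ ∞ ϱ (Icc a b))
    {Λ : ℝ → ℝ} (hΛ : ContDiffOn ℝ ∞ Λ (Icc a b)) :
    CurveODE a b ϱ Λ γ ↔
      ∀ x ∈ Icc a b, HasDerivWithinAt (momentum a b ϱ Λ γ) 0 (Icc a b) x := by
  unfold CurveODE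
  simp only [iteratedDerivWithin_succ_eq 3, iteratedDerivWithin_succ_eq 2,
    iteratedDerivWithin_succ_eq 1, iteratedDerivWithin_one_eq]
  refine forall₂_congr fun x hx => ?_
  have hu := uniqueDiffOn_Icc hab
  have s1 := contDiffOn_derivWithin_Icc hab hγ
  have s2 := contDiffOn_derivWithin_Icc hab s1
  have s3 := contDiffOn_derivWithin_Icc hab s2
  have r1 := contDiffOn_derivWithin_Icc hab hϱ
  have d1 := hasDerivWithinAt_Icc s1 hx
  have d2 := hasDerivWithinAt_Icc s2 hx
  have d3 := hasDerivWithinAt_Icc s3 hx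
  have e0 := hasDerivWithinAt_Icc hϱ hx
  have e1 := hasDerivWithinAt_Icc r1 hx
  have l0 := hasDerivWithinAt_Icc hΛ hx
  set T := derivWithin γ (Icc a b) with hT
  set T₁ := derivWithin T (Icc a b) with hT1
  have hQ : EqOn (derivWithin (fun y => ϱ y • T₁ y) (Icc a b))
      (fun y => ϱ y • derivWithin T₁ (Icc a b) y + derivWithin ϱ (Icc a b) y • T₁ y)
      (Icc a b) := fun y hy =>
    ((hasDerivWithinAt_Icc hϱ hy).smul (hasDerivWithinAt_Icc s2 hy)).derivWithin (hu y hy)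
  have hd := ((e0.smul d3).add (e1.smul d2)).add
    ((((e0.const_mul (3 / 2)).mul (d2.inner ℝ d2)).sub l0).smul d1)
  have hd' := hd.congr (f₁ := momentum a b ϱ Λ γ) (fun y hy => by
    simp only [momentum, ← hT, ← hT1, hQ hy]; rfl) (by
    simp only [momentum, ← hT, ← hT1, hQ hx]; rfl)
  rw [real_inner_comm (T₁ x) (derivWithin T₁ (Icc a b) x)] at hd'
  rw [real_inner_comm (T₁ x) (derivWithin T₁ (Icc a b) x)]
  have key : ∀ v w : E n, w = v → HasDerivWithinAt (momentum a b ϱ Λ γ) w (Icc a b) x →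
      (v = 0 ↔ HasDerivWithinAt (momentum a b ϱ Λ γ) 0 (Icc a b) x) := by
    rintro v _ rfl hw
    exact ⟨fun h => h ▸ hw, fun h => (hw.derivWithin (hu x hx)).symm.trans
      (h.derivWithin (hu x hx))⟩
  refine key _ _ ?_ hd'
  simp only [Pi.mul_apply, Pi.sub_apply]
  module

/-- Differentiate `|γ'|² = 1`. -/
theorem inner_derivWithin_derivWithin_eq_zero {n : ℕ} {a b : ℝ} (hab : a < b) {γ : ℝ → E n}
    (hγ : ContDiffOn ℝ ∞ γ (Icc a b)) (harc : IsArcLengthParam a b γ) :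
    ∀ x ∈ Icc a b, inner ℝ (derivWithin γ (Icc a b) x)
      (derivWithin (derivWithin γ (Icc a b)) (Icc a b) x) = 0 := by
  intro x hx
  have d1 := hasDerivWithinAt_Icc (contDiffOn_derivWithin_Icc hab hγ) hx
  have h1 := (d1.inner ℝ d1).derivWithin (uniqueDiffOn_Icc hab x hx)
  have h2 : derivWithin (fun y => inner ℝ (derivWithin γ (Icc a b) y)
      (derivWithin γ (Icc a b) y)) (Icc a b) x = 0 := by
    rw [derivWithin_congr (f := fun _ => (1 : ℝ)) (fun y hy => by
      rw [real_inner_self_eq_norm_sq, harc y hy, one_pow])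
      (by rw [real_inner_self_eq_norm_sq, harc x hx, one_pow])]
    simp
  rw [h2, real_inner_comm (derivWithin γ (Icc a b) x)] at h1
  rw [real_inner_comm] at h1 ⊢
  linarith

/-! ### The differential equation implies elasticity -/

theorem eq_zero_and_deriv_eq_zero_of_vanish_near_endpoints {F : Type} [NormedAddCommGroup F]
    [NormedSpace ℝ F] {a b δ : ℝ} (hδ : 0 < δ) {X : ℝ → F}
    (hX : ∀ x, x ∉ Ioo (a + δ) (b - δ) → X x = 0) {x : ℝ} (hx : x ∉ Ioo a b) :
    X x = 0 ∧ deriv X x = 0 := by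
  have hx' : x ∈ (Icc (a + δ) (b - δ))ᶜ := fun h =>
    hx ⟨by linarith [h.1], by linarith [h.2]⟩
  have hev : X =ᶠ[𝓝 x] fun _ => 0 := by
    filter_upwards [isClosed_Icc.isOpen_compl.mem_nhds hx'] with y hy
    exact hX y fun h => hy ⟨h.1.le, h.2.le⟩
  exact ⟨hev.eq_of_nhds, by rw [hev.deriv_eq, deriv_const]⟩

/-- A curve satisfying the fourth-order equation is elastic. -/
theorem isElastic_of_curveODE {n : ℕ} {a b : ℝ} (hab : a < b) {γ : ℝ → E n}
    (hγ : ContDiffOn ℝ ∞ γ (Icc a b)) (harc : IsArcLengthParam a b γ) {ϱ : ℝ → ℝ}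
    (hϱ : ContDiffOn ℝ ∞ ϱ (Icc a b)) {Λ : ℝ → ℝ} (hΛ : ContDiffOn ℝ ∞ Λ (Icc a b))
    (h : CurveODE a b ϱ Λ γ) : IsElastic a b ϱ γ := by
  refine ⟨harc, fun ε γt hv hc hp => ?_⟩
  obtain ⟨X, hX, ⟨δ, hδ, hXz⟩, hXT, -, hder⟩ := exists_variation_field hab hγ harc hϱ hv hc hp
  refine hder.congr_deriv ?_
  rw [curveODE_iff_hasDerivWithinAt_momentum hab hγ hϱ hΛ] at h
  have s1 := contDiffOn_derivWithin_Icc hab hγ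
  have s2 := contDiffOn_derivWithin_Icc hab s1
  have hX' : ContDiff ℝ ∞ (deriv X) := (contDiff_infty_iff_deriv.1 hX).2
  have hX'' : ContDiff ℝ ∞ (deriv (deriv X)) := (contDiff_infty_iff_deriv.1 hX').2
  set T := derivWithin γ (Icc a b) with hT
  set T₁ := derivWithin T (Icc a b) with hT1
  have hP : ContDiffOn ℝ ∞ (fun y => ϱ y • T₁ y) (Icc a b) := hϱ.smul s2
  have hC : ContinuousOn (momentum a b ϱ Λ γ) (Icc a b) := fun x hx =>
    (h x hx).continuousWithinAt
  -- An explicit primitive of the first variation: the momentum is constant and differs from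
  -- `(ϱT')'` by a multiple of `T`, which is orthogonal to `X'`, so only `ϱ⟨T', X''⟩` survives.
  have hFTC := intervalIntegral.integral_eq_sub_of_hasDerivAt_of_le hab.le
    (f := fun x => inner ℝ (ϱ x • T₁ x) (deriv X x) - inner ℝ (momentum a b ϱ Λ γ x) (X x))
    (f' := fun x => ϱ x * inner ℝ (T₁ x) (deriv (deriv X) x))
    ((hP.continuousOn.inner hX'.continuous.continuousOn).sub
      (hC.inner hX.continuous.continuousOn))
    (fun x hx => by
      have hxI := Ioo_subset_Icc_self hx
      have hn := Icc_mem_nhds hx.1 hx.2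
      have i1 := (hasDerivAt_Ioo hP hx).inner ℝ (hX'.differentiable (by simp) x).hasDerivAt
      have i2 := ((h x hxI).hasDerivAt hn).inner ℝ (hX.differentiable (by simp) x).hasDerivAt
      refine (i1.sub i2).congr_deriv ?_
      simp only [momentum, ← hT, ← hT1, inner_add_left, real_inner_smul_left, inner_zero_left,
        hXT x hxI]
      ring)
    ((hϱ.continuousOn.mul (s2.continuousOn.inner
      hX''.continuous.continuousOn)).intervalIntegrable_of_Icc hab.le)
  rw [hFTC]
  have hz : ∀ x, x ∉ Ioo a b → X x = 0 ∧ deriv X x = 0 :=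
    fun x hx => eq_zero_and_deriv_eq_zero_of_vanish_near_endpoints hδ hXz hx
  have ha := hz a fun h => lt_irrefl _ h.1
  have hb := hz b fun h => lt_irrefl _ h.2
  simp [ha.1, ha.2, hb.1, hb.2]

/-! ### Admissible variations from prescribed normal fields -/

/-- The scale factor that renormalizes `T + u` when `T` is a unit vector orthogonal to `u`. -/
def renormFactor {n : ℕ} (u : E n) : ℝ := (√(1 + ‖u‖ ^ 2))⁻¹

/-- The difference between the normalization of `T + u` and `T`, for a unit vector `T`
orthogonal to `u`. -/
def renormDiff {n : ℕ} (T u : E n) : E n :=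
  (renormFactor u - 1) • T + renormFactor u • u

theorem contDiff_renormFactor {n : ℕ} : ContDiff ℝ ∞ (renormFactor (n := n)) := by
  have h : ∀ u : E n, 0 < 1 + ‖u‖ ^ 2 := fun u => by positivity
  exact ((contDiff_const.add (contDiff_norm_sq ℝ)).sqrt fun u => (h u).ne').inv
    fun u => (Real.sqrt_pos.2 (h u)).ne'

/-- The factor depends on `u` only through `‖u‖²`, which has no first-order part at `0`.
Renormalizing therefore does not alter the first-order change of the tangent. -/
theorem hasFDerivAt_renormFactor_zero {n : ℕ} :
    HasFDerivAt (renormFactor (n := n)) (0 : E n →L[ℝ] ℝ) 0 := by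
  have h1 : HasFDerivAt (fun u : E n => ‖u‖ ^ 2) (0 : E n →L[ℝ] ℝ) 0 := by
    have := (hasStrictFDerivAt_norm_sq (0 : E n)).hasFDerivAt
    simpa using this
  have h2 : HasDerivAt (fun r : ℝ => (√(1 + r))⁻¹) (deriv (fun r : ℝ => (√(1 + r))⁻¹) 0)
      (‖(0 : E n)‖ ^ 2) := by
    have : DifferentiableAt ℝ (fun r : ℝ => (√(1 + r))⁻¹) 0 := by
      refine DifferentiableAt.inv (DifferentiableAt.sqrt (by fun_prop) ?_) ?_ <;> simp
    simpa using this.hasDerivAt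
  have := h2.comp_hasFDerivAt (0 : E n) h1
  rw [smul_zero] at this
  exact this

theorem renormDiff_zero {n : ℕ} (T : E n) : renormDiff T 0 = 0 := by
  simp [renormDiff, renormFactor]

theorem hasFDerivAt_renormDiff_zero {n : ℕ} (T : E n) :
    HasFDerivAt (renormDiff T) (ContinuousLinearMap.id ℝ (E n)) 0 := by
  have h1 := (hasFDerivAt_renormFactor_zero (n := n))
  have h2 := ((h1.sub_const 1).smul_const T).add (h1.smul (hasFDerivAt_id (𝕜 := ℝ) (0 : E n)))
  refine h2.congr_fderiv ?_
  ext1 v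
  simp [renormFactor]

/-- Pythagoras: `‖T + u‖² = 1 + ‖u‖²`. -/
theorem norm_add_renormDiff {n : ℕ} {T u : E n} (hT : ‖T‖ = 1) (h : inner ℝ T u = 0) :
    ‖T + renormDiff T u‖ = 1 := by
  have h1 : T + renormDiff T u = renormFactor u • (T + u) := by
    unfold renormDiff; module
  have h2 : ‖T + u‖ = √(1 + ‖u‖ ^ 2) := by
    rw [eq_comm, Real.sqrt_eq_iff_eq_sq (by positivity) (norm_nonneg _),
      norm_add_sq_real, h, hT]
    ring
  have hpos : 0 < √(1 + ‖u‖ ^ 2) := Real.sqrt_pos.2 (by positivity)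
  rw [h1, norm_smul, h2, renormFactor, norm_inv, Real.norm_of_nonneg hpos.le,
    inv_mul_cancel₀ hpos.ne']

/-- A tangential field with vanishing integral is the infinitesimal change of the tangent along
an admissible variation, provided that it belongs to a family of fields whose integrals span
the whole space. -/
theorem exists_variation_of_field {n : ℕ} {a b : ℝ} (hab : a < b) {γ : ℝ → E n}
    (hγ : ContDiffOn ℝ ∞ γ (Icc a b)) (harc : IsArcLengthParam a b γ)
    {L : ℝ → (ℝ × E n) →L[ℝ] E n} (hL : ContDiff ℝ ∞ L) {δ : ℝ} (hδ : 0 < δ)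
    (hLz : ∀ x, x ∉ Ioo (a + δ) (b - δ) → L x = 0)
    (hLT : ∀ x ∈ Icc a b, ∀ s, inner ℝ (derivWithin γ (Icc a b) x) (L x s) = 0)
    (hLint : ∫ x in a..b, L x = ContinuousLinearMap.snd ℝ ℝ (E n)) :
    ∃ (ε : ℝ) (γt : ℝ → ℝ → E n), IsSmoothVariation a b γ ε γt ∧
      HasCompactSupportInInterior a b γ ε γt ∧ PreservesArcLength a b γ ε γt ∧
      ∀ x, HasDerivAt (fun t => γt t x) (∫ y in a..x, L y (1, 0)) 0 := by
  have hTs := contDiffOn_derivWithin_Icc hab hγ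
  set T := derivWithin γ (Icc a b) with hT
  set d : (ℝ × E n) × ℝ → E n := fun q => renormDiff (T q.2) (L q.2 q.1) with hd
  have hdz : ∀ s x, x ∉ Ioo (a + δ) (b - δ) → d (s, x) = 0 := fun s x hx => by
    simp [hd, hLz x hx, renormDiff_zero]
  have hds : ContDiff ℝ ∞ d := by
    have h1 : ContDiffOn ℝ ∞ d (univ ×ˢ Ioo a b) := by
      have hT2 : ContDiffOn ℝ ∞ (fun q : (ℝ × E n) × ℝ => T q.2) (univ ×ˢ Ioo a b) :=
        hTs.comp contDiffOn_snd fun q hq => Ioo_subset_Icc_self hq.2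
      have hL2 : ContDiff ℝ ∞ (fun q : (ℝ × E n) × ℝ => L q.2 q.1) :=
        (hL.comp contDiff_snd).clm_apply contDiff_fst
      have hφ := contDiff_renormFactor.comp hL2
      exact ((hφ.sub contDiff_const).contDiffOn.smul hT2).add (hφ.smul hL2).contDiffOn
    have h2 := contDiffOn_of_vanish_near_endpoints isOpen_univ hδ h1
      fun s _ x hx => hdz s x hx
    rwa [univ_prod_univ, contDiffOn_univ] at h2
  have hd0 : ∀ y, d (0, y) = 0 := fun y => by simp [hd, renormDiff_zero]
  have hdd : ∀ y, (fderiv ℝ d (0, y)).comp (ContinuousLinearMap.inl ℝ (ℝ × E n) ℝ) = L y := by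
    intro y
    have h1 : HasFDerivAt (fun s => d (s, y)) (L y) 0 := by
      have h2 : HasFDerivAt (renormDiff (T y)) (ContinuousLinearMap.id ℝ (E n)) (L y 0) := by
        rw [map_zero]; exact hasFDerivAt_renormDiff_zero (T y)
      exact h2.comp (0 : ℝ × E n) (L y).hasFDerivAt
    have h3 : HasFDerivAt (fun s : ℝ × E n => (s, y))
        (ContinuousLinearMap.inl ℝ (ℝ × E n) ℝ) 0 := hasFDerivAt_prodMk_left 0 y
    have h4 : HasFDerivAt d (fderiv ℝ d (0, y)) (0, y) :=
      (hds.differentiable (by simp) (0, y)).hasFDerivAt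
    exact (HasFDerivAt.comp (0 : ℝ × E n) (g := d) h4 h3).unique h1
  set G : (ℝ × E n) × ℝ → E n := fun q => ∫ y in a..q.2, d (q.1, y) with hG
  have hGs : ContDiff ℝ ∞ G := contDiff_parametric_primitive hds a
  have hG0 : ∀ x, G (0, x) = 0 := fun x => by simp [hG, hd0]
  have hGd : ∀ x, HasFDerivAt (fun s => G (s, x)) (∫ y in a..x, L y) 0 := by
    intro x
    have := hasFDerivAt_parametric_integral (hds.of_le (m := 1) (by simp)) a x (0 : ℝ × E n)
    simpa only [hdd] using this
  -- The second component is the closing defect at `b`. By `hLint` its derivative at `0` is the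
  -- second projection, so `Φ` has derivative the identity.
  set Φ : ℝ × E n → ℝ × E n := fun s => (s.1, G (s, b)) with hΦ
  have hΦs : ContDiff ℝ ∞ Φ :=
    contDiff_fst.prodMk (hGs.comp (contDiff_prodMk_left b))
  have hΦd : HasFDerivAt Φ (ContinuousLinearMap.id ℝ (ℝ × E n)) 0 := by
    have h1 := hGd b
    rw [hLint] at h1
    exact hasFDerivAt_fst.prodMk h1
  obtain ⟨Ψ, hΨ0, hΨ, hΨd⟩ := exists_smooth_local_inverse hΦs
    (by simp [hΦ, hG0]) hΦd
  -- A curve of parameters with zero closing defect and initial velocity `(1, 0)`.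
  set σ : ℝ → ℝ × E n := fun t => Ψ (t, 0) with hσ
  have hσ0 : σ 0 = 0 := hΨ0
  have hσd : HasDerivAt σ (1, 0) 0 := by
    have h1 : HasDerivAt (fun t : ℝ => (t, (0 : E n))) (1, 0) 0 :=
      (hasDerivAt_id (0 : ℝ)).prodMk (hasDerivAt_const (0 : ℝ) (0 : E n))
    exact hΨd.comp_hasDerivAt (0 : ℝ) h1
  have hσe : ∀ᶠ t in 𝓝 (0 : ℝ), ContDiffAt ℝ ∞ σ t ∧ G (σ t, b) = 0 := by
    have hc : ContinuousAt (fun t : ℝ => (t, (0 : E n))) 0 := by fun_prop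
    filter_upwards [hc.eventually hΨ] with t ht
    refine ⟨ht.1.comp t (contDiff_prodMk_left (0 : E n)).contDiffAt, ?_⟩
    exact congrArg Prod.snd ht.2
  obtain ⟨r, hr, hball⟩ := Metric.eventually_nhds_iff.1 hσe
  have hball' : ∀ t ∈ Icc (-(r / 2)) (r / 2), ContDiffAt ℝ ∞ σ t ∧ G (σ t, b) = 0 := by
    intro t ht
    refine hball ?_
    rw [Real.dist_eq, sub_zero, abs_lt]
    exact ⟨by linarith [ht.1], by linarith [ht.2]⟩
  have hGx : ∀ s x, HasDerivAt (fun x => G (s, x)) (d (s, x)) x := fun s x =>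
    intervalIntegral.integral_hasDerivAt_right
      ((hds.continuous.comp (Continuous.prodMk_right s)).intervalIntegrable _ _)
      ((hds.continuous.comp (Continuous.prodMk_right s)).stronglyMeasurableAtFilter _ _)
      (hds.continuous.comp (Continuous.prodMk_right s)).continuousAt
  have hGzero : ∀ s, ∀ u v : ℝ, (∀ y ∈ uIcc u v, y ∉ Ioo (a + δ) (b - δ)) →
      ∫ y in u..v, d (s, y) = 0 := by
    intro s u v h
    rw [intervalIntegral.integral_congr (g := fun _ => (0 : E n))
      fun y hy => hdz s y (h y hy)]
    simp
  refine ⟨r / 2, fun t x => γ x + G (σ t, x), ⟨half_pos hr, ?_, ?_⟩, ⟨δ, hδ, ?_⟩, ?_, ?_⟩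
  · refine (hγ.comp contDiffOn_snd fun p hp => hp.2).add ?_
    rintro ⟨t, x⟩ hp
    have h1 : ContDiffAt ℝ ∞ (fun p : ℝ × ℝ => (σ p.1, p.2)) (t, x) :=
      ((hball' t hp.1).1.comp (t, x) contDiffAt_fst).prodMk contDiffAt_snd
    exact (hGs.contDiffAt.comp (t, x) h1).contDiffWithinAt
  · intro x _
    simp [hσ0, hG0]
  · rintro t ht x hx hx'
    suffices G (σ t, x) = 0 by simp [this]
    rcases hx' with hx' | hx'
    · refine hGzero _ _ _ fun y hy h => ?_
      rw [uIcc_of_le hx'.1] at hy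
      exact absurd h.1 (not_lt.2 (hy.2.trans hx'.2))
    · have hcd : Continuous fun y => d (σ t, y) :=
        hds.continuous.comp (Continuous.prodMk_right (σ t))
      -- The integrand vanishes beyond `b - δ`, so the displacement there equals the closing defect,
      -- which is zero.
      have h1 := intervalIntegral.integral_add_adjacent_intervals
        (hcd.intervalIntegrable (μ := volume) a x) (hcd.intervalIntegrable x b)
      have h2 : ∫ y in x..b, d (σ t, y) = 0 := by
        refine hGzero _ _ _ fun y hy h => ?_
        rw [uIcc_of_le hx'.2] at hy
        exact absurd h.2 (not_lt.2 (hx'.1.trans hy.1))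
      rw [h2, add_zero] at h1
      exact h1.trans (hball' t ht).2
  · intro t ht x hx
    have h1 := ((hasDerivWithinAt_Icc hγ hx).add (hGx (σ t) x).hasDerivWithinAt).derivWithin
      (uniqueDiffOn_Icc hab x hx)
    have h2 : derivWithin (fun x => γ x + G (σ t, x)) (Icc a b) x = T x + d (σ t, x) := h1
    rw [h2, harc x hx]
    exact norm_add_renormDiff (harc x hx) (hLT x hx _)
  · intro x
    have h1 : HasFDerivAt (fun s => G (s, x)) (∫ y in a..x, L y) (σ 0) := by
      rw [hσ0]; exact hGd x
    have h2 := (h1.comp_hasDerivAt (0 : ℝ) hσd).const_add (γ x)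
    rw [ContinuousLinearMap.intervalIntegral_apply
      (hL.continuous.intervalIntegrable _ _)] at h2
    exact h2

/-! ### Elasticity implies the differential equation -/

/-- The first variation of an elastic curve, after integration by parts. -/
theorem integral_inner_eq_zero_of_isElastic {n : ℕ} {a b : ℝ} (hab : a < b) {γ : ℝ → E n}
    (hγ : ContDiffOn ℝ ∞ γ (Icc a b)) {ϱ : ℝ → ℝ} (hϱ : ContDiffOn ℝ ∞ ϱ (Icc a b))
    (hel : IsElastic a b ϱ γ)
    {L : ℝ → (ℝ × E n) →L[ℝ] E n} (hL : ContDiff ℝ ∞ L) {δ : ℝ} (hδ : 0 < δ)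
    (hLz : ∀ x, x ∉ Ioo (a + δ) (b - δ) → L x = 0)
    (hLT : ∀ x ∈ Icc a b, ∀ s, inner ℝ (derivWithin γ (Icc a b) x) (L x s) = 0)
    (hLint : ∫ x in a..b, L x = ContinuousLinearMap.snd ℝ ℝ (E n)) :
    ∫ x in a..b, inner ℝ (derivWithin (fun y => ϱ y •
      derivWithin (derivWithin γ (Icc a b)) (Icc a b) y) (Icc a b) x) (L x (1, 0)) = 0 := by
  obtain ⟨harc, hcrit⟩ := hel
  obtain ⟨ε, γt, hv, hc, hp, hγtd⟩ :=
    exists_variation_of_field hab hγ harc hL hδ hLz hLT hLint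
  obtain ⟨X, hX, ⟨η, hη, hXz⟩, -, hXd, hder⟩ := exists_variation_field hab hγ harc hϱ hv hc hp
  have hzero := hder.unique (hcrit ε γt hv hc hp)
  have s1 := contDiffOn_derivWithin_Icc hab hγ
  have s2 := contDiffOn_derivWithin_Icc hab s1
  have hX' : ContDiff ℝ ∞ (deriv X) := (contDiff_infty_iff_deriv.1 hX).2
  have hX'' : ContDiff ℝ ∞ (deriv (deriv X)) := (contDiff_infty_iff_deriv.1 hX').2
  have hV : Continuous fun y => L y (1, 0) := hL.continuous.clm_apply continuous_const
  set T := derivWithin γ (Icc a b) with hT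
  set T₁ := derivWithin T (Icc a b) with hT1
  have hP : ContDiffOn ℝ ∞ (fun y => ϱ y • T₁ y) (Icc a b) := hϱ.smul s2
  have hQ := contDiffOn_derivWithin_Icc hab hP
  -- Both descriptions of the velocity at `t = 0` agree on `[a, b]`; differentiate inside and reach
  -- the end points by continuity.
  have hXV : EqOn (deriv X) (fun y => L y (1, 0)) (Icc a b) := by
    refine EqOn.of_subset_closure (s := Ioo a b) (fun x hx => ?_) hX'.continuous.continuousOn
      hV.continuousOn Ioo_subset_Icc_self (closure_Ioo hab.ne).ge
    have hev : X =ᶠ[𝓝 x] fun x => ∫ y in a..x, L y (1, 0) := by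
      filter_upwards [Icc_mem_nhds hx.1 hx.2] with z hz
      exact (hXd z hz).unique (hγtd z)
    rw [hev.deriv_eq]
    exact hV.deriv_integral _ _ _
  have i1 : IntervalIntegrable (fun x => inner ℝ (derivWithin (fun y => ϱ y • T₁ y)
      (Icc a b) x) (deriv X x)) volume a b :=
    (hQ.continuousOn.inner hX'.continuous.continuousOn).intervalIntegrable_of_Icc hab.le
  have i2 : IntervalIntegrable (fun x => ϱ x * inner ℝ (T₁ x) (deriv (deriv X) x))
      volume a b :=
    (hϱ.continuousOn.mul (s2.continuousOn.inner
      hX''.continuous.continuousOn)).intervalIntegrable_of_Icc hab.le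
  have hFTC := intervalIntegral.integral_eq_sub_of_hasDerivAt_of_le hab.le
    (f := fun x => inner ℝ (ϱ x • T₁ x) (deriv X x))
    (f' := fun x => inner ℝ (derivWithin (fun y => ϱ y • T₁ y) (Icc a b) x) (deriv X x)
      + ϱ x * inner ℝ (T₁ x) (deriv (deriv X) x))
    (hP.continuousOn.inner hX'.continuous.continuousOn)
    (fun x hx => by
      have j1 := (hasDerivAt_Ioo hP hx).inner ℝ (hX'.differentiable (by simp) x).hasDerivAt
      refine j1.congr_deriv ?_
      rw [real_inner_smul_left]
      ring)
    (i1.add i2)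
  have ha := eq_zero_and_deriv_eq_zero_of_vanish_near_endpoints hη hXz
    (x := a) fun h => lt_irrefl _ h.1
  have hb := eq_zero_and_deriv_eq_zero_of_vanish_near_endpoints hη hXz
    (x := b) fun h => lt_irrefl _ h.2
  rw [intervalIntegral.integral_add i1 i2, hzero, add_zero, ha.2, hb.2, inner_zero_right,
    inner_zero_right, sub_zero] at hFTC
  rw [← hFTC]
  refine intervalIntegral.integral_congr fun x hx => ?_
  rw [uIcc_of_le hab.le] at hx
  simp only [hXV hx]

/-- The orthogonal projection to the complement of a unit vector `T`. -/
def normalProj {n : ℕ} (T : E n) : E n →L[ℝ] E n :=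
  ContinuousLinearMap.id ℝ (E n) - (innerSL ℝ T).smulRight T

theorem normalProj_apply {n : ℕ} (T v : E n) : normalProj T v = v - inner ℝ T v • T := by
  simp [normalProj]

theorem contDiff_normalProj {n : ℕ} : ContDiff ℝ ∞ (normalProj (n := n)) :=
  contDiff_const.sub ((innerSL ℝ).contDiff.smulRight contDiff_id)

theorem inner_normalProj {n : ℕ} {T : E n} (hT : ‖T‖ = 1) (v : E n) :
    inner ℝ T (normalProj T v) = 0 := by
  rw [normalProj_apply, inner_sub_right, real_inner_smul_right, real_inner_self_eq_norm_sq, hT]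
  ring

/-- The projection is symmetric and idempotent. -/
theorem inner_normalProj_self {n : ℕ} {T : E n} (hT : ‖T‖ = 1) (v : E n) :
    inner ℝ v (normalProj T v) = ‖normalProj T v‖ ^ 2 := by
  rw [← real_inner_self_eq_norm_sq]
  nth_rewrite 2 [normalProj_apply]
  rw [inner_sub_left, real_inner_smul_left, inner_normalProj hT, mul_zero, sub_zero]

theorem contDiff_bump_smul {F : Type} [NormedAddCommGroup F] [NormedSpace ℝ F] {a b δ : ℝ}
    (hδ : 0 < δ) {χ : ℝ → ℝ} (hχ : ContDiff ℝ ∞ χ)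
    (hχz : ∀ x, x ∉ Ioo (a + δ) (b - δ) → χ x = 0) {f : ℝ → F}
    (hf : ContDiffOn ℝ ∞ f (Icc a b)) : ContDiff ℝ ∞ fun x => χ x • f x :=
  contDiff_of_vanish_near_endpoints hδ (hχ.contDiffOn.smul (hf.mono Ioo_subset_Icc_self))
    fun x hx => by simp [hχz x hx]

/-- On a curve that is not straight, there is a family of tangential fields with prescribed
integrals. -/
theorem exists_fields_with_integral {n : ℕ} {a b : ℝ} (hab : a < b) {γ : ℝ → E n}
    (hγ : ContDiffOn ℝ ∞ γ (Icc a b)) (harc : IsArcLengthParam a b γ) {x₀ : ℝ}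
    (hx₀ : x₀ ∈ Ioo a b)
    (hne : derivWithin (derivWithin γ (Icc a b)) (Icc a b) x₀ ≠ 0) :
    ∃ W : ℝ → E n →L[ℝ] E n, ContDiff ℝ ∞ W ∧
      (∃ δ > 0, ∀ x, x ∉ Ioo (a + δ) (b - δ) → W x = 0) ∧
      (∀ x ∈ Icc a b, ∀ v, inner ℝ (derivWithin γ (Icc a b) x) (W x v) = 0) ∧
      ∀ v, ∫ x in a..b, W x v = v := by
  have s1 := contDiffOn_derivWithin_Icc hab hγ
  have hTT := inner_derivWithin_derivWithin_eq_zero hab hγ harc x₀ (Ioo_subset_Icc_self hx₀)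
  have hTd := hasDerivAt_Ioo s1 hx₀
  unfold IsArcLengthParam at harc
  set T := derivWithin γ (Icc a b) with hT
  set T₁ := derivWithin T (Icc a b) with hT1
  obtain ⟨χ, hχ, hχ0, hχx, δ, hδ, hχz⟩ := exists_bump hx₀
  set K : ℝ → E n →L[ℝ] E n := fun x => χ x • normalProj (T x) with hK
  have hKs : ContDiff ℝ ∞ K :=
    contDiff_bump_smul hδ hχ hχz (contDiff_normalProj.comp_contDiffOn s1)
  set M : E n →L[ℝ] E n := ∫ x in a..b, K x with hM
  have hMv : ∀ v, M v = ∫ x in a..b, K x v := fun v =>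
    ContinuousLinearMap.intervalIntegral_apply (hKs.continuous.intervalIntegrable _ _) v
  -- If `M w = 0`, then `∫ χ |Pw|² = 0` with `P` the normal projection, so `w = ⟨T, w⟩T` near `x₀`.
  -- Differentiating at `x₀` and pairing with `T' ⟂ T` gives `⟨T, w⟩|T'|² = 0`; as `T' x₀ ≠ 0`, both
  -- `⟨T, w⟩` and `w` vanish.
  have hinj : Function.Injective M := by
    rw [injective_iff_map_eq_zero]
    intro w hw
    have h1 : ∫ x in a..b, χ x * ‖normalProj (T x) w‖ ^ 2 = 0 := by
      have h2 : innerSL ℝ w (M w) = ∫ x in a..b, innerSL ℝ w (K x w) := by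
        rw [hMv, ContinuousLinearMap.intervalIntegral_comp_comm]
        exact (hKs.continuous.clm_apply continuous_const).intervalIntegrable _ _
      rw [hw, map_zero] at h2
      rw [h2]
      refine intervalIntegral.integral_congr fun x hx => ?_
      rw [uIcc_of_le hab.le] at hx
      simp only [hK, _root_.smul_apply, map_smul, smul_eq_mul, innerSL_apply_apply,
        inner_normalProj_self (harc x hx)]
    have hPc : ContinuousOn (fun x => normalProj (T x) w) (Icc a b) :=
      (contDiff_normalProj.continuous.comp_continuousOn s1.continuousOn).clm_apply
        continuousOn_const
    have hev : (fun x => w - inner ℝ (T x) w • T x) =ᶠ[𝓝 x₀] fun _ => 0 := by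
      filter_upwards [isOpen_Ioo.mem_nhds hx₀, hχ.continuous.continuousAt.eventually_ne hχx]
        with x hx hx'
      have := eq_zero_of_integral_mul_eq_zero (χ := χ)
        (f := fun x => ‖normalProj (T x) w‖ ^ 2)
        (hχ.continuous.continuousOn.mul (hPc.norm.pow 2)) hχ0 (fun x => by positivity) hx hx' h1
      rw [← normalProj_apply]
      simpa using this
    have hd : HasDerivAt (fun x => w - inner ℝ (T x) w • T x) _ x₀ :=
      ((hTd.inner ℝ (hasDerivAt_const x₀ w)).smul hTd).const_sub w
    have hd0 := hd.unique ((hasDerivAt_const x₀ (0 : E n)).congr_of_eventuallyEq hev)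
    have h3 := congrArg (inner ℝ (T₁ x₀)) hd0
    rw [inner_neg_right, inner_add_right, real_inner_smul_right,
      real_inner_smul_right, real_inner_comm (T x₀), hTT, mul_zero, add_zero, inner_zero_right,
      neg_eq_zero, mul_eq_zero] at h3
    have h4 := h3.resolve_right (inner_self_ne_zero.2 hne)
    have h5 := hev.eq_of_nhds
    simpa [h4] using h5
  let e := LinearEquiv.ofInjectiveEndo (M : E n →ₗ[ℝ] E n) hinj
  set N : E n →L[ℝ] E n := LinearMap.toContinuousLinearMap (e.symm : E n →ₗ[ℝ] E n) with hN
  have hMN : ∀ v, M (N v) = v := fun v => e.apply_symm_apply v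
  refine ⟨fun x => (K x).comp N, hKs.clm_comp contDiff_const, ⟨δ, hδ, fun x hx => ?_⟩,
    fun x hx v => ?_, fun v => ?_⟩
  · have hKx : K x = 0 := by
      simp only [hK, hχz x hx]
      exact zero_smul ℝ (normalProj (T x))
    simp only [hKx, ContinuousLinearMap.zero_comp]
  · simp [hK, real_inner_smul_right, inner_normalProj (harc x hx)]
  · exact (hMv (N v)).symm.trans (hMN v)

/-- The Euler-Lagrange equation of an elastic curve, tested with tangential fields, with the
Lagrange multiplier `c` of the end point constraint. -/
theorem exists_multiplier_of_isElastic {n : ℕ} {a b : ℝ} (hab : a < b) {γ : ℝ → E n}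
    (hγ : ContDiffOn ℝ ∞ γ (Icc a b)) {ϱ : ℝ → ℝ} (hϱ : ContDiffOn ℝ ∞ ϱ (Icc a b))
    (hel : IsElastic a b ϱ γ) {x₀ : ℝ} (hx₀ : x₀ ∈ Ioo a b)
    (hne : derivWithin (derivWithin γ (Icc a b)) (Icc a b) x₀ ≠ 0) :
    ∃ c : E n, ∀ V : ℝ → E n, ContDiff ℝ ∞ V →
      (∃ δ > 0, ∀ x, x ∉ Ioo (a + δ) (b - δ) → V x = 0) →
      (∀ x ∈ Icc a b, inner ℝ (derivWithin γ (Icc a b) x) (V x) = 0) →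
      ∫ x in a..b, inner ℝ (derivWithin (fun y => ϱ y •
        derivWithin (derivWithin γ (Icc a b)) (Icc a b) y) (Icc a b) x - c) (V x) = 0 := by
  obtain ⟨W, hW, ⟨δ₁, hδ₁, hWz⟩, hWT, hWint⟩ :=
    exists_fields_with_integral hab hγ hel.1 hx₀ hne
  have s2 := contDiffOn_derivWithin_Icc hab (contDiffOn_derivWithin_Icc hab hγ)
  have hQ := contDiffOn_derivWithin_Icc hab (hϱ.smul s2)
  have horth := fun L => integral_inner_eq_zero_of_isElastic hab hγ hϱ hel (L := L)
  change ContDiffOn ℝ ∞ (derivWithin (fun y => ϱ y •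
    derivWithin (derivWithin γ (Icc a b)) (Icc a b) y) (Icc a b)) (Icc a b) at hQ
  set Q := derivWithin (fun y => ϱ y •
    derivWithin (derivWithin γ (Icc a b)) (Icc a b) y) (Icc a b) with hQdef
  have hℓ : IntervalIntegrable (fun x => (innerSL ℝ (Q x)).comp (W x)) volume a b := by
    refine ContinuousOn.intervalIntegrable_of_Icc hab.le ?_
    exact ((innerSL ℝ).continuous.comp_continuousOn hQ.continuousOn).clm_comp
      hW.continuous.continuousOn
  -- The Riesz vector of `v ↦ ∫ ⟨Q, W v⟩`.
  refine ⟨(InnerProductSpace.toDual ℝ (E n)).symm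
    (∫ x in a..b, (innerSL ℝ (Q x)).comp (W x)), fun V hV ⟨δ₂, hδ₂, hVz⟩ hVT => ?_⟩
  set c := (InnerProductSpace.toDual ℝ (E n)).symm
    (∫ x in a..b, (innerSL ℝ (Q x)).comp (W x)) with hc
  have hcv : ∀ v, inner ℝ c v = ∫ x in a..b, inner ℝ (Q x) (W x v) := by
    intro v
    rw [hc, InnerProductSpace.toDual_symm_apply, ContinuousLinearMap.intervalIntegral_apply hℓ]
    rfl
  set v₀ := ∫ x in a..b, V x with hv₀
  have hVi : IntervalIntegrable V volume a b := hV.continuous.intervalIntegrable _ _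
  have hWi : ∀ v, IntervalIntegrable (fun x => W x v) volume a b := fun v =>
    (hW.continuous.clm_apply continuous_const).intervalIntegrable _ _
  -- The field `V - W v₀` has zero integral, so `(τ, v) ↦ W v + τ(V - W v₀)` integrates to `v`. At
  -- `(1, 0)` elasticity yields `∫ ⟨Q, V⟩ = ∫ ⟨Q, W v₀⟩ = ⟨c, v₀⟩ = ∫ ⟨c, V⟩`.
  set L : ℝ → (ℝ × E n) →L[ℝ] E n := fun x =>
    (W x).comp (ContinuousLinearMap.snd ℝ ℝ (E n)) +
      (ContinuousLinearMap.fst ℝ ℝ (E n)).smulRight (V x - W x v₀) with hLdef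
  have hLs : ContDiff ℝ ∞ L := (hW.clm_comp contDiff_const).add
    (contDiff_const.smulRight (hV.sub (hW.clm_apply contDiff_const)))
  have h0 := horth L hLs (δ := min δ₁ δ₂) (lt_min hδ₁ hδ₂) (fun x hx => by
      have h1 : W x = 0 := hWz x fun h => hx
        ⟨by linarith [h.1, min_le_left δ₁ δ₂], by linarith [h.2, min_le_left δ₁ δ₂]⟩
      have h2 : V x = 0 := hVz x fun h => hx
        ⟨by linarith [h.1, min_le_right δ₁ δ₂], by linarith [h.2, min_le_right δ₁ δ₂]⟩
      refine ContinuousLinearMap.ext fun s => ?_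
      simp [hLdef, h1, h2])
    (fun x hx s => by
      simp [hLdef, inner_add_right, inner_sub_right, real_inner_smul_right, hWT x hx, hVT x hx])
    (by
      refine ContinuousLinearMap.ext fun s => ?_
      rw [ContinuousLinearMap.intervalIntegral_apply (hLs.continuous.intervalIntegrable _ _)]
      have : ∀ x, L x s = W x s.2 + s.1 • (V x - W x v₀) := fun x => rfl
      have hi : IntervalIntegrable (fun x => s.1 • (V x - W x v₀)) volume a b :=
        (hVi.sub (hWi v₀)).smul s.1
      simp only [this]
      rw [intervalIntegral.integral_add (hWi _) hi,
        intervalIntegral.integral_smul, intervalIntegral.integral_sub hVi (hWi _), hWint, hWint,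
        ← hv₀, sub_self, smul_zero, add_zero]
      rfl)
  have hL1 : ∀ x, L x (1, 0) = V x - W x v₀ := fun x => by simp [hLdef]
  simp only [hL1, inner_sub_right] at h0
  have iQV : IntervalIntegrable (fun x => inner ℝ (Q x) (V x)) volume a b :=
    (hQ.continuousOn.inner hV.continuous.continuousOn).intervalIntegrable_of_Icc hab.le
  have iQW : IntervalIntegrable (fun x => inner ℝ (Q x) (W x v₀)) volume a b :=
    (hQ.continuousOn.inner (hW.continuous.clm_apply
      continuous_const).continuousOn).intervalIntegrable_of_Icc hab.le
  have icV : IntervalIntegrable (fun x => inner ℝ c (V x)) volume a b :=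
    (continuous_const.inner hV.continuous).intervalIntegrable _ _
  have hcV : inner ℝ c v₀ = ∫ x in a..b, inner ℝ c (V x) :=
    ((innerSL ℝ c).intervalIntegral_comp_comm hVi).symm
  rw [intervalIntegral.integral_sub iQV iQW, ← hcv, hcV] at h0
  simp only [inner_sub_left]
  rw [intervalIntegral.integral_sub iQV icV, h0]

/-- An elastic curve satisfies the fourth-order equation for some multiplier. -/
theorem exists_curveODE_of_isElastic {n : ℕ} {a b : ℝ} (hab : a < b) {γ : ℝ → E n}
    (hγ : ContDiffOn ℝ ∞ γ (Icc a b)) {ϱ : ℝ → ℝ} (hϱ : ContDiffOn ℝ ∞ ϱ (Icc a b))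
    (hel : IsElastic a b ϱ γ) :
    ∃ Λ : ℝ → ℝ, ContDiffOn ℝ ∞ Λ (Icc a b) ∧ CurveODE a b ϱ Λ γ := by
  have s1 := contDiffOn_derivWithin_Icc hab hγ
  have s2 := contDiffOn_derivWithin_Icc hab s1
  have hmult := fun x₀ => exists_multiplier_of_isElastic hab hγ hϱ hel (x₀ := x₀)
  have hode := fun Λ => curveODE_iff_hasDerivWithinAt_momentum hab hγ hϱ (Λ := Λ)
  have harc := hel.1
  unfold IsArcLengthParam at harc
  unfold momentum at hode
  set T := derivWithin γ (Icc a b) with hT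
  set T₁ := derivWithin T (Icc a b) with hT1
  have hQ : ContDiffOn ℝ ∞ (derivWithin (fun y => ϱ y • T₁ y) (Icc a b)) (Icc a b) :=
    contDiffOn_derivWithin_Icc hab (hϱ.smul s2)
  set Q := derivWithin (fun y => ϱ y • T₁ y) (Icc a b) with hQdef
  suffices ∃ c : E n, ∃ Λ : ℝ → ℝ, ContDiffOn ℝ ∞ Λ (Icc a b) ∧ ∀ x ∈ Icc a b,
      Q x + (3 / 2 * ϱ x * inner ℝ (T₁ x) (T₁ x) - Λ x) • T x = c by
    obtain ⟨c, Λ, hΛ, h⟩ := this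
    refine ⟨Λ, hΛ, (hode Λ hΛ).2 fun x hx => ?_⟩
    exact (hasDerivWithinAt_const x (Icc a b) c).congr h (h x hx)
  by_cases hstraight : ∀ x ∈ Ioo a b, T₁ x = 0
  · have hz : EqOn T₁ (fun _ => 0) (Icc a b) :=
      EqOn.of_subset_closure (s := Ioo a b) hstraight s2.continuousOn continuousOn_const
        Ioo_subset_Icc_self (closure_Ioo hab.ne).ge
    refine ⟨0, fun _ => 0, contDiffOn_const, fun x hx => ?_⟩
    have hQx : Q x = 0 := by
      rw [hQdef, derivWithin_congr (f := fun _ => (0 : E n))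
        (fun y hy => by simp [hz hy]) (by simp [hz hx])]
      simp
    simp [hQx, hz hx]
  · push Not at hstraight
    obtain ⟨x₀, hx₀, hne⟩ := hstraight
    obtain ⟨c, hc⟩ := hmult x₀ hx₀ hne
    have hPs : ContDiffOn ℝ ∞ (fun x => normalProj (T x) (Q x - c)) (Icc a b) :=
      (contDiff_normalProj.comp_contDiffOn s1).clm_apply (hQ.sub contDiffOn_const)
    have hzero : EqOn (fun x => normalProj (T x) (Q x - c)) (fun _ => 0) (Icc a b) := by
      refine EqOn.of_subset_closure (s := Ioo a b) (fun x hx => ?_) hPs.continuousOn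
        continuousOn_const Ioo_subset_Icc_self (closure_Ioo hab.ne).ge
      obtain ⟨χ, hχ, hχ0, hχx, δ, hδ, hχz⟩ := exists_bump hx
      -- Testing with a bump times the normal part of `Q - c` turns the integrand into `χ` times the
      -- squared norm of that part.
      have h1 := hc (fun x => χ x • normalProj (T x) (Q x - c))
        (contDiff_bump_smul hδ hχ hχz hPs) ⟨δ, hδ, fun y hy => by simp [hχz y hy]⟩
        (fun y hy => by simp only [real_inner_smul_right, inner_normalProj (harc y hy), mul_zero])
      have h2 : ∫ x in a..b, χ x * ‖normalProj (T x) (Q x - c)‖ ^ 2 = 0 := by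
        rw [← h1]
        refine intervalIntegral.integral_congr fun y hy => ?_
        rw [uIcc_of_le hab.le] at hy
        simp only [real_inner_smul_right, inner_normalProj_self (harc y hy)]
      have h3 := eq_zero_of_integral_mul_eq_zero (χ := χ)
        (f := fun x => ‖normalProj (T x) (Q x - c)‖ ^ 2)
        (hχ.continuous.continuousOn.mul (hPs.continuousOn.norm.pow 2)) hχ0
        (fun x => by positivity) hx hχx h2
      simpa using h3
    -- This `Λ` leaves `T` the coefficient `-⟨T, Q - c⟩`, which cancels the tangential part of `Q -
    -- c`.
    refine ⟨c, fun x => 3 / 2 * ϱ x * inner ℝ (T₁ x) (T₁ x) + inner ℝ (T x) (Q x - c),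
      ((contDiffOn_const.mul hϱ).mul (s2.inner ℝ s2)).add
        (s1.inner ℝ (hQ.sub contDiffOn_const)), fun x hx => ?_⟩
    have h4 := hzero hx
    simp only [normalProj_apply] at h4
    rw [sub_add_cancel_left, neg_smul, ← sub_eq_add_neg, ← sub_eq_zero, ← h4]
    abel

end VariableStiffness

end

/-! ### Assembly of the equivalences -/

theorem theorem3p3 {n : ℕ} {a b : ℝ} (hab : a < b)
    (γ : ℝ → VariableStiffness.E n) (hγ : ContDiffOn ℝ ∞ γ (Set.Icc a b))
    (harc : VariableStiffness.IsArcLengthParam a b γ)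
    (ϱ : ℝ → ℝ) (hϱ : ContDiffOn ℝ ∞ ϱ (Set.Icc a b)) (hpos : ∀ x ∈ Set.Icc a b, 0 < ϱ x) :
    (VariableStiffness.IsElastic a b ϱ γ ↔
      ∃ Λ : ℝ → ℝ, ContDiffOn ℝ ∞ Λ (Set.Icc a b) ∧
        ∀ x ∈ Set.Icc a b, VariableStiffness.constrainedGradient a b ϱ γ Λ x = 0) ∧
    (VariableStiffness.IsElastic a b ϱ γ ↔
      ∃ Λ : ℝ → ℝ, ContDiffOn ℝ ∞ Λ (Set.Icc a b) ∧
        VariableStiffness.TangentODE a b ϱ Λ (VariableStiffness.tangent a b γ)) ∧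
    (VariableStiffness.IsElastic a b ϱ γ ↔
      ∃ Λ : ℝ → ℝ, ContDiffOn ℝ ∞ Λ (Set.Icc a b) ∧
        VariableStiffness.CurveODE a b ϱ Λ γ) ∧
    (∀ Λ : ℝ → ℝ, ContDiffOn ℝ ∞ Λ (Set.Icc a b) →
      ((∀ x ∈ Set.Icc a b, VariableStiffness.constrainedGradient a b ϱ γ Λ x = 0) ↔
        VariableStiffness.TangentODE a b ϱ (fun x => 2 * Λ x)
          (VariableStiffness.tangent a b γ)) ∧
      (VariableStiffness.TangentODE a b ϱ Λ (VariableStiffness.tangent a b γ) ↔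
        VariableStiffness.CurveODE a b ϱ Λ γ)) := by
  have h23 := fun Λ (hΛ : ContDiffOn ℝ ∞ Λ (Set.Icc a b)) =>
    VariableStiffness.constrainedGradient_eq_zero_iff_tangentODE hab harc ϱ hΛ
  have h34 := fun Λ => VariableStiffness.tangentODE_iff_curveODE harc ϱ Λ
  have h14 : VariableStiffness.IsElastic a b ϱ γ ↔
      ∃ Λ : ℝ → ℝ, ContDiffOn ℝ ∞ Λ (Set.Icc a b) ∧ VariableStiffness.CurveODE a b ϱ Λ γ :=
    ⟨VariableStiffness.exists_curveODE_of_isElastic hab hγ hϱ, fun ⟨_, hΛ, h⟩ =>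
      VariableStiffness.isElastic_of_curveODE hab hγ harc hϱ hΛ h⟩
  have h13 : VariableStiffness.IsElastic a b ϱ γ ↔
      ∃ Λ : ℝ → ℝ, ContDiffOn ℝ ∞ Λ (Set.Icc a b) ∧
        VariableStiffness.TangentODE a b ϱ Λ (VariableStiffness.tangent a b γ) :=
    h14.trans (exists_congr fun Λ => and_congr_right fun _ => (h34 Λ).symm)
  refine ⟨h13.trans ⟨?_, ?_⟩, h13, h14, fun Λ hΛ => ⟨h23 Λ hΛ, h34 Λ⟩⟩
  · rintro ⟨Λ, hΛ, h⟩
    have hΛ' : ContDiffOn ℝ ∞ (fun x => 2⁻¹ * Λ x) (Set.Icc a b) := contDiffOn_const.mul hΛ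
    refine ⟨fun x => 2⁻¹ * Λ x, hΛ', (h23 _ hΛ').2 ?_⟩
    simpa only [mul_inv_cancel_left₀ (two_ne_zero : (2 : ℝ) ≠ 0)] using h
  · rintro ⟨Λ, hΛ, h⟩
    exact ⟨fun x => 2 * Λ x, contDiffOn_const.mul hΛ, (h23 Λ hΛ).1 h⟩
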